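/- **Setting.** Let $d\ge 2$, $n\ge 1$, and let $f=\frac1n\sum_{i=1}^n f_i$, where the $f_i$ are real functions on $\mathbb R^d$ that are scale invariant of the same type: either $f_i(cx)=|c|^pf_i(x)$ for all $i$ (multiplicative, degree $p\in\mathbb R$), or $f_i(cx)=f_i(x)+\log_a|c|$ for all $i$ (additive, with a common base $a>0$, $a\ne1$; then put $p=0$), for all $c\neq0$, $x\ne0$. Consider $\max f(x)$ subject to $\|x\|=1$. Let $x^*$ be a local maximizer, $\lambda^*$ its Lagrange multiplier, $\nabla f(x^*)=\lambda^*x^*$, let $v_1=x^*,v_2,\dots,v_d$ be an orthonormal basis with $\nabla^2f(x^*)v_i=\lambda_iv_i$, let $\sigma=\|\nabla^2f(x^*)\|$, and assume $\lambda^*>\bar\lambda:=\max_{2\le i\le d}|\lambda_i|$. All norms are 2-norms. **Algorithm (S-SCI-PI).** Step size $\eta\in(0,1]$, batch size $1\le s\le n$, epoch length $m\ge1$, initial point $\tilde x_0$ with $\|\tilde x_0\|=1$. For $T=0,1,\dots$: put $x_0=\tilde x_T$; for $t=0,\dots,m-1$ draw $S_t$ uniformly (independently of all other draws) from the set $B_s$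 of subsets of $\{1,\dots,n\}$ of size $s$, and put $\alpha_t=|x_t^Tx_0|^{p-1}/\|x_0\|^{2(p-1)}$, $$g_t=\alpha_t\nabla f(x_0)+\tfrac1s\sum_{l\in S_t}\big[\nabla f_l(x_t)-\alpha_t\nabla f_l(x_0)\big],\qquad x_{t+1}=(1-\eta)x_t+\eta\, g_t/\|x_t\|^{p-2};$$ finally $\tilde x_{T+1}=x_m$. Write $$\Delta=1-\tilde x_0^Tx^*,\qquad \tilde\delta_T=\frac{E\big[\sum_{k=2}^d(\tilde x_T^Tv_k)^2\big]}{E\big[(\tilde x_T^Tv_1)^2\big]} .$$ **Constants.** Let $\mathcal D$ be a compact set that contains the segments $[y,x^*]$ and $[y,(y^Ty')y']$ for all unit vectors $y,y'$ with $1-y^Tx^*\le\Delta$ and $1-y'^Tx^*\le\Delta$; for example, $\mathcal D$ is the closed unit ball. Assume that every $f_i$ is $C^2$, and $f$ is $C^3$, on an open set containing the unit sphere and $\mathcal D$. Let $H_j$ be the Hessian of the partial derivative $\nabla_jf$, let $F_i(y^1,\dots,y^d)=(\lambda^*-\lambda_1)\mathbf 1_{i=1}I+\sum_{j}v_{ij}H_j(y^j)$,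 where $v_{ij}$ is the $j$-th coordinate of $v_i$, and for $S\in B_s$ let $G_S(y^1,\dots,y^d)$ be the matrix whose $j$-th row is $\nabla\nabla_jg_S(y^j)^T$, where $g_S=\frac1{|S|}\sum_{l\in S}f_l-f$. With $x,z$ ranging over the unit sphere and $y=(y^1,\dots,y^d)$ over $\mathcal D^d$, put $M=\max(M_1,M_2)$, $$M_1=\max_{x,y}\sqrt{\textstyle\sum_i(x^TF_i(y)x)^2},\quad M_2=\max_{x,z,y}\Big|\textstyle\sum_iz_i\,x^TH_i(y^i)x\Big|,\quad K=\max_y E_{S\sim B_s}\|G_S(y)\|^2,\quad L=\max_{S\in B_s,\,y}\|G_S(y)\|^2,$$ and let $L_0$ be the value of $L$ for batch size $1$. Put $\theta_1=\lambda^*+\sigma+M\sqrt{\Delta/2}+2\sqrt L$, $\theta_2=\lambda^*-\bar\lambda-2\sqrt{\Delta}\,(M+2\sqrt L)$ and $$\nu_1=1-\lambda^*+2\theta_1m\sqrt{2\Delta},\quad \nu_2=m\lambda^*+1-(m+1)(\bar\lambda+M\sqrt{\Delta}),\quad \nu_3=\frac{128L\theta_1\lambda^*m^2}{\theta_2^2\bar\lambda\,\Delta\sqrt{\Delta}}+1-(\bar\lambda+M\sqrt{\Delta}),$$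 $$\nu_4=1-\lambda^*-M\sqrt{\Delta}+\max\Big(\sqrt{Km},\tfrac{64K}{\lambda^*-\bar\lambda-2M\sqrt{\Delta}}\Big),\quad \nu_5=1-\lambda^*+M\sqrt{\Delta}+\max\Big(2m(\lambda^*-\bar\lambda-2M\sqrt{\Delta}),\tfrac{4mM\sqrt{\Delta}}{\log2}\Big).$$ **Theorem.** Suppose that 1. $\Delta\le1-\frac1{\sqrt2}$, $\;4(M+2\sqrt{L_0})^2\Delta\le(\lambda^*-\bar\lambda)^2$ and $\lambda^*-\bar\lambda-2M\sqrt{\Delta}>0$ (given the second inequality, the last one can fail only if $L_0=0$ and equality holds in the second); 2. either $L\le\frac1{32}(\lambda^*-\bar\lambda-2M\sqrt{\Delta})^2$, or the denominator $\theta_2^2\bar\lambda\Delta\sqrt{\Delta}$ in $\nu_3$ is nonzero and $\eta\le1/\max(1,\nu_1,\nu_2,\nu_3)$; 3. $\eta\le1/\max(1,\nu_4,\nu_5)$. Put $$\rho=\frac{\eta m(\lambda^*-\bar\lambda-2M\sqrt{\Delta})}{2\big(1-\eta+\eta(\lambda^*-M\sqrt{\Delta})\big)} .$$ Then $0<\rho<1$;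 for every $T\ge0$ the two expectations in $\tilde\delta_T$ are finite, $E[(\tilde x_T^Tv_1)^2]>0$ and $\tilde\delta_{T+1}\le(1-\rho)\tilde\delta_T$. Consequently, for every $\epsilon>0$, $\tilde\delta_\tau\le\epsilon$ for $\tau=\lceil(1/\rho)\log(\tilde\delta_0/\epsilon)\rceil$ (read $\tau=0$ if $\tilde\delta_0\le\epsilon$). -/

import Mathlib

open MeasureTheory ProbabilityTheory
open scoped RealInnerProductSpace

noncomputable section

namespace SSCIPI

/-- `ℝ^d` with the Euclidean norm. -/
abbrev E (d : ℕ) : Type := EuclideanSpace ℝ (Fin d)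

variable {d n : ℕ}

/-! ### Scale invariant functions, averages and derivatives -/

/-- Multiplicative scale invariance `g (c x) = |c|^p g x`, away from the origin. -/
def MulScaleInvariant (p : ℝ) (g : E d → ℝ) : Prop :=
  ∀ c : ℝ, c ≠ 0 → ∀ x : E d, x ≠ 0 → g (c • x) = |c| ^ p * g x

/-- Additive scale invariance `g (c x) = g x + log_a |c|`, away from the origin. -/
def AddScaleInvariant (a : ℝ) (g : E d → ℝ) : Prop :=
  ∀ c : ℝ, c ≠ 0 → ∀ x : E d, x ≠ 0 → g (c • x) = g x + Real.logb a |c|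

/-- All the `f_i` are scale invariant of the same type, and `p` is the degree: the exponent in the
multiplicative case, `0` in the additive case. -/
def ScaleInvariantFamily (p : ℝ) (f : Fin n → E d → ℝ) : Prop :=
  (∀ i, MulScaleInvariant p (f i)) ∨
    (p = 0 ∧ ∃ a : ℝ, 0 < a ∧ a ≠ 1 ∧ ∀ i, AddScaleInvariant a (f i))

/-- The objective `f = (1/n) ∑ f_i`. -/
def avg (f : Fin n → E d → ℝ) (x : E d) : ℝ := (∑ i, f i x) / n

/-- The mini-batch function `f_S = ∑_{l ∈ S} f_l / |S|`. -/
def batch (f : Fin n → E d → ℝ) (S : Finset (Fin n)) (x : E d) : ℝ :=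
  (∑ l ∈ S, f l x) / S.card

/-- The `j`-th coordinate `∇_j g` of the gradient of `g`. -/
def gradCoord (g : E d → ℝ) (j : Fin d) (x : E d) : ℝ := gradient g x j

/-- The Hessian `∇² g (x)`, as a linear operator (its norm is the spectral norm). -/
def hessian (g : E d → ℝ) (x : E d) : E d →L[ℝ] E d := fderiv ℝ (gradient g) x

/-! ### The constants `λ̄`, `M`, `K`, `L` -/

/-- `λ̄ = max_{i ≥ 2} |λ_i|`; indices start at `0 : Fin d`, so the first index is `0`. -/
def lamBar [NeZero d] (lam : Fin d → ℝ) : ℝ := ⨆ i : {i : Fin d // i ≠ 0}, |lam i|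

/-- `F_i(y¹,…,y^d) = (λ* - λ_1) 1_{i = 1} I + ∑_j v_{ij} H_j(y^j)`, where `H_j` is the Hessian of
`∇_j g` and `v_{ij}` is the `j`-th coordinate of `v_i`. -/
def opF [NeZero d] (g : E d → ℝ) (lamStar : ℝ) (lam : Fin d → ℝ)
    (v : OrthonormalBasis (Fin d) ℝ (E d)) (i : Fin d) (y : Fin d → E d) : E d →L[ℝ] E d :=
  (if i = 0 then lamStar - lam 0 else 0) • ContinuousLinearMap.id ℝ (E d)
    + ∑ j, (v i j) • hessian (gradCoord g j) (y j)

/-- `M_1`, with the points `y^j` ranging over `D`. -/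
def constM1 [NeZero d] (g : E d → ℝ) (lamStar : ℝ) (lam : Fin d → ℝ)
    (v : OrthonormalBasis (Fin d) ℝ (E d)) (D : Set (E d)) : ℝ :=
  sSup {r | ∃ (x : E d) (y : Fin d → E d), ‖x‖ = 1 ∧ (∀ j, y j ∈ D) ∧
    r = √(∑ i, ⟪x, opF g lamStar lam v i y x⟫ ^ 2)}

/-- `M_2`, with the points `y^j` ranging over `D`. -/
def constM2 (g : E d → ℝ) (D : Set (E d)) : ℝ :=
  sSup {r | ∃ (x z : E d) (y : Fin d → E d), ‖x‖ = 1 ∧ ‖z‖ = 1 ∧ (∀ j, y j ∈ D) ∧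
    r = |∑ i, z i * ⟪x, hessian (gradCoord g i) (y i) x⟫|}

/-- `M = max (M_1, M_2)`. -/
def constM [NeZero d] (g : E d → ℝ) (lamStar : ℝ) (lam : Fin d → ℝ)
    (v : OrthonormalBasis (Fin d) ℝ (E d)) (D : Set (E d)) : ℝ :=
  max (constM1 g lamStar lam v D) (constM2 g D)

/-- The set `B_s` of all mini-batches of size `s`. -/
def batches (n s : ℕ) : Finset (Finset (Fin n)) := Finset.powersetCard s Finset.univ

/-- `G_S(y¹,…,y^d)`: the matrix whose `j`-th row is the gradient at `y^j` of `∇_j g_S`, where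
`g_S = f_S - f`. -/
def matG (f : Fin n → E d → ℝ) (S : Finset (Fin n)) (y : Fin d → E d) :
    Matrix (Fin d) (Fin d) ℝ :=
  Matrix.of fun j k => gradient (gradCoord (fun x => batch f S x - avg f x) j) (y j) k

/-- The spectral norm of `G_S(y¹,…,y^d)`. -/
def normG (f : Fin n → E d → ℝ) (S : Finset (Fin n)) (y : Fin d → E d) : ℝ :=
  ‖Matrix.toEuclideanCLM (𝕜 := ℝ) (n := Fin d) (matG f S y)‖

/-- `K = max_y E_{S ∼ B_s} ‖G_S(y)‖²`, with the points `y^j` ranging over `D`. -/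
def constK (f : Fin n → E d → ℝ) (s : ℕ) (D : Set (E d)) : ℝ :=
  sSup {r | ∃ y : Fin d → E d, (∀ j, y j ∈ D) ∧
    r = (∑ S ∈ batches n s, normG f S y ^ 2) / (batches n s).card}

/-- `L = max_{S ∈ B_s, y} ‖G_S(y)‖²`, with the points `y^j` ranging over `D`. -/
def constL (f : Fin n → E d → ℝ) (s : ℕ) (D : Set (E d)) : ℝ :=
  sSup {r | ∃ S ∈ batches n s, ∃ y : Fin d → E d, (∀ j, y j ∈ D) ∧ r = normG f S y ^ 2}

/-- The unit vectors `y` with `1 - yᵀx* ≤ Δ`. -/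
def cap (xstar : E d) (Δ : ℝ) : Set (E d) := {y | ‖y‖ = 1 ∧ 1 - ⟪y, xstar⟫ ≤ Δ}

/-- `D` contains the segments `[y, x*]` and `[y, (yᵀy')y']` for all `y, y'` in the cap. As these
lie in the closed unit ball, the closed unit ball is always such a set. -/
def ContainsSegments (xstar : E d) (Δ : ℝ) (D : Set (E d)) : Prop :=
  (∀ y ∈ cap xstar Δ, segment ℝ y xstar ⊆ D) ∧
    ∀ y ∈ cap xstar Δ, ∀ y' ∈ cap xstar Δ, segment ℝ y (⟪y, y'⟫ • y') ⊆ D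

lemma containsSegments_closedBall (xstar : E d) (hx : ‖xstar‖ = 1) (Δ : ℝ) :
    ContainsSegments xstar Δ (Metric.closedBall 0 1) := by
  refine ⟨fun y hy => ?_, fun y hy y' hy' => ?_⟩
  · refine (convex_closedBall (0 : E d) 1).segment_subset ?_ ?_
    · simp [hy.1]
    · simp [hx]
  · refine (convex_closedBall (0 : E d) 1).segment_subset ?_ ?_
    · simp [hy.1]
    · have h := abs_real_inner_le_norm y y'
      rw [hy.1, hy'.1] at h
      simpa [norm_smul, hy'.1] using h

/-! ### The algorithm -/

/-- One inner iteration: from the current iterate `x`, with outer iterate `x0` and mini-batch `S`,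
`α = |xᵀx0|^{p-1} / ‖x0‖^{2(p-1)}`,
`g = α ∇f(x0) + |S|⁻¹ ∑_{l ∈ S} (∇f_l(x) - α ∇f_l(x0))`, and the new iterate is
`(1-η) x + η g / ‖x‖^{p-2}`. -/
def stepIter (f : Fin n → E d → ℝ) (p η : ℝ) (x0 : E d) (S : Finset (Fin n)) (x : E d) : E d :=
  let α : ℝ := |⟪x, x0⟫| ^ (p - 1) / ‖x0‖ ^ (2 * (p - 1))
  let g : E d := α • gradient (avg f) x0
    + (S.card : ℝ)⁻¹ • ∑ l ∈ S, (gradient (f l) x - α • gradient (f l) x0)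
  (1 - η) • x + (η / ‖x‖ ^ (p - 2)) • g

/-- The inner loop: `x_t`, started at `x0`, with mini-batches `S 0, S 1, …`. -/
def innerIter (f : Fin n → E d → ℝ) (p η : ℝ) (x0 : E d) (S : ℕ → Finset (Fin n)) : ℕ → E d
  | 0 => x0
  | t + 1 => stepIter f p η x0 (S t) (innerIter f p η x0 S t)

/-- The outer loop: `x̃_T`, with epoch length `m`; `S T t` is the mini-batch drawn in inner
iteration `t` of epoch `T`. -/
def outerIter (f : Fin n → E d → ℝ) (p η : ℝ) (m : ℕ) (x0 : E d) (S : ℕ → ℕ → Finset (Fin n)) :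
    ℕ → E d
  | 0 => x0
  | T + 1 => innerIter f p η (outerIter f p η m x0 S T) (S T) m

/-- The mini-batches `S T t` are independent and uniformly distributed on `B_s`. -/
structure UniformBatches {Ω : Type*} [MeasurableSpace Ω] (μ : Measure Ω) (s : ℕ)
    (S : ℕ → ℕ → Ω → Finset (Fin n)) : Prop where
  measurable : ∀ T t, Measurable[_, ⊤] (S T t)
  uniform : ∀ T t, ∀ A ∈ batches n s, μ.real {ω | S T t ω = A} = 1 / (batches n s).card
  indep : iIndepFun (m := fun _ => (⊤ : MeasurableSpace (Finset (Fin n))))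
    (fun q : ℕ × ℕ => S q.1 q.2) μ

/-- `∑_{k ≥ 2} (xᵀv_k)²`. -/
def tailSq [NeZero d] (v : OrthonormalBasis (Fin d) ℝ (E d)) (x : E d) : ℝ :=
  ∑ k ∈ Finset.univ.filter (fun k : Fin d => k ≠ 0), ⟪x, v k⟫ ^ 2

/-- `(xᵀv_1)²`. -/
def headSq [NeZero d] (v : OrthonormalBasis (Fin d) ℝ (E d)) (x : E d) : ℝ := ⟪x, v 0⟫ ^ 2

/-- The optimality gap `E[∑_{k ≥ 2} (Xᵀv_k)²] / E[(Xᵀv_1)²]` of a random vector `X`. -/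
def gap [NeZero d] {Ω : Type*} [MeasurableSpace Ω] (μ : Measure Ω)
    (v : OrthonormalBasis (Fin d) ℝ (E d)) (X : Ω → E d) : ℝ :=
  (∫ ω, tailSq v (X ω) ∂μ) / ∫ ω, headSq v (X ω) ∂μ

/-! ### Step-size thresholds; `ls = λ*`, `lb = λ̄`, `Δ = Δ̃_0` -/

def theta1 (ls σ M L Δ : ℝ) : ℝ := ls + σ + M * √(Δ / 2) + 2 * √L

def theta2 (ls lb M L Δ : ℝ) : ℝ := ls - lb - 2 * √Δ * (M + 2 * √L)

def nu1 (ls σ M L Δ : ℝ) (m : ℕ) : ℝ := 1 - ls + 2 * theta1 ls σ M L Δ * m * √(2 * Δ)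

def nu2 (ls lb M Δ : ℝ) (m : ℕ) : ℝ := m * ls + 1 - (m + 1) * (lb + M * √Δ)

/-- The denominator in `ν_3`. -/
def nu3Den (ls lb M L Δ : ℝ) : ℝ := theta2 ls lb M L Δ ^ 2 * lb * Δ * √Δ

def nu3 (ls lb σ M L Δ : ℝ) (m : ℕ) : ℝ :=
  128 * L * theta1 ls σ M L Δ * ls * m ^ 2 / nu3Den ls lb M L Δ + 1 - (lb + M * √Δ)

def nu4 (ls lb M K Δ : ℝ) (m : ℕ) : ℝ :=
  1 - ls - M * √Δ + max √(K * m) (64 * K / (ls - lb - 2 * M * √Δ))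

def nu5 (ls lb M Δ : ℝ) (m : ℕ) : ℝ :=
  1 - ls + M * √Δ + max (2 * m * (ls - lb - 2 * M * √Δ)) (4 * m * M * √Δ / Real.log 2)

/-- The rate `ρ`. -/
def rho (ls lb M Δ η : ℝ) (m : ℕ) : ℝ :=
  η * m * (ls - lb - 2 * M * √Δ) / (2 * (1 - η + η * (ls - M * √Δ)))

end SSCIPI

end

/-!
Write `y` for the direction of an iterate `x`, `u = ⟨y, x*⟩`, and `x_⊥` for the part of `x`
orthogonal to `x* = v 0`. Scale invariance makes gradients homogeneous of degree `p - 1`, so one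
inner iteration is `x ↦ ‖x‖ ((1 - η) y + η (∇f(y) + e_S))`, with noise
`e_S = ∇g_S(y) - ∇g_S(⟨y, y0⟩ y0)`, where `y0` is the direction of the outer iterate
(`stepIter_eq`). A second order Taylor estimate with the constant `M` gives
`∇f(y) = λ* u x* + ∇²f(x*) y_⊥ + r` with `‖r‖ ≤ M (1 - u)` (`exists_gradient_eq`): without noise the
iteration is a perturbed power iteration, which multiplies `⟨x, x*⟩` by at least
`α = 1 - η + η (λ* - M √Δ)` and `‖x_⊥‖` by at most `β = 1 - η + η (λ̄ + M √Δ)`.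

The noise has mean zero, and its mean square is at most `K` times the squared distance `h²` from `y`
to the line of `y0`. The definition of `K` takes the same evaluation point for all the mini-batches;
this suffices, because the mean value inequality is applied to the vector of all the mini-batch
gradients at once (`sum_norm_gradient_sub_sq_le`). Since `‖x‖² h²` is at most
`2 ‖x_⊥‖² + 2 τ ⟨x, x*⟩²`, where `τ ≤ 1` is the squared tangent of the angle between the outer iterate
and `x*`, the expectations `B` of `‖x_⊥‖²` and `W` of `τ ⟨x, x*⟩²` satisfy a closed linear recursion
over the epoch (`CapModel.average_step`, `CapModel.epoch_integral`). They agree at its start, and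
`epoch_recursion_bound` shows that `B` falls by the factor `(1 - ρ) α ^ (2 m)`, whereas the
expectation of `⟨x, x*⟩²` grows by at least `α ^ (2 m)`.

All this needs the iterates to stay, for every choice of the mini-batches, in the cone over the
initial cap. One step stays in it as long as on its boundary the spectral gap beats `M Δ + √L h`
(`CapModel.step_mem_cone`). If `L` is small this holds for all directions in the cap; otherwise
`ν₁` and `ν₃` make `h` small throughout an epoch, which starts with `h = 0`
(`CapModel.innerIter_mem_cone`).
-/

namespace SSCIPI

variable {d n : ℕ}

/-! ### Real and vector-valued estimates -/

/-- First order Taylor estimate with the sharp constant `1 / 2`, for vector-valued functions. -/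
lemma norm_sub_sub_le_half_of_deriv_two {F : Type*} [NormedAddCommGroup F] [NormedSpace ℝ F]
    {Γ Γ' Γ'' : ℝ → F} {C : ℝ}
    (h1 : ∀ t ∈ Set.Icc (0 : ℝ) 1, HasDerivAt Γ (Γ' t) t)
    (h2 : ∀ t ∈ Set.Icc (0 : ℝ) 1, HasDerivAt Γ' (Γ'' t) t)
    (hC : ∀ t ∈ Set.Icc (0 : ℝ) 1, ‖Γ'' t‖ ≤ C) : ‖Γ 1 - Γ 0 - Γ' 0‖ ≤ C / 2 := by
  have hΓ' : ∀ t ∈ Set.Icc (0 : ℝ) 1, ‖Γ' t - Γ' 0‖ ≤ C * t := by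
    intro t ht
    have := Convex.norm_image_sub_le_of_norm_hasDerivWithin_le
      (fun s hs => (h2 s hs).hasDerivWithinAt) hC (convex_Icc 0 1)
      (Set.left_mem_Icc.2 zero_le_one) ht
    simpa [Real.norm_eq_abs, abs_of_nonneg ht.1] using this
  have hd : ∀ t ∈ Set.Icc (0 : ℝ) 1,
      HasDerivAt (fun t => Γ t - Γ 0 - t • Γ' 0) (Γ' t - Γ' 0) t := by
    intro t ht
    have := ((h1 t ht).sub_const (Γ 0)).fun_sub ((hasDerivAt_id t).smul_const (Γ' 0))
    simpa using this
  have hB : ∀ t : ℝ, HasDerivAt (fun t => C * t ^ 2 / 2) (C * t) t := by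
    intro t
    have := ((hasDerivAt_pow 2 t).const_mul C).div_const 2
    refine this.congr_deriv ?_
    push_cast
    ring
  have key := image_norm_le_of_norm_deriv_right_le_deriv_boundary
    (f := fun t => Γ t - Γ 0 - t • Γ' 0) (a := 0) (b := 1)
    (fun t ht => (hd t ht).continuousAt.continuousWithinAt)
    (fun t ht => (hd t (Set.Ico_subset_Icc_self ht)).hasDerivWithinAt)
    (by simp) hB (fun t ht => hΓ' t (Set.Ico_subset_Icc_self ht))
    (Set.right_mem_Icc.2 zero_le_one)
  simpa using key

/-- The linear recursion of one epoch. Here `B` and `W` are the expectations of the squared orthogonal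
part and of the squared parallel part weighted by the squared tangent of the outer iterate; `1 - q`
and `1 + p` are the factors of the mean step and `k` is the relative strength of the noise.
The noise uses up at most half of the decrease: `W` stays below `7 R ^ t B0` and `B` below
`R ^ t B0`, so that each step injects at most `16 k ≤ 2 q / 5` relative to a decrease of `9 q / 8`. -/
lemma epoch_recursion_bound {m : ℕ} {q p k R B0 : ℝ} (hR : 0 < R) (hq0 : 0 ≤ q) (hp0 : 0 ≤ p)
    (hk0 : 0 ≤ k) (hq : q * (2 * m) ≤ 1) (hp : 2 * p * m ≤ Real.log 2) (hk : 40 * k ≤ q)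
    (hB0 : 0 ≤ B0) {B W : ℕ → ℝ} (hBz : B 0 = B0) (hWz : W 0 = B0)
    (hB : ∀ t < m, B (t + 1) ≤ R * ((1 - q) ^ 2 * B t + k * (2 * B t + 2 * W t)))
    (hW : ∀ t < m, W (t + 1) ≤ R * ((1 + p) ^ 2 * W t + k * (2 * B t + 2 * W t))) :
    B m ≤ (1 - m * q / 2) * (R ^ m * B0) := by
  have hlog : (1 : ℝ) / 2 ≤ Real.log 2 := by
    have := Real.log_two_gt_d9
    linarith
  have key : ∀ t ≤ m, B t ≤ (1 - t * q / 2) * (R ^ t * B0) ∧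
      W t + R ^ t * B0 ≤ 2 * Real.exp (t * (2 * p + 2 * k)) * (R ^ t * B0) := by
    intro t
    induction t with
    | zero => intro _; simp [hBz, hWz]; linarith
    | succ t ih =>
      intro ht
      obtain ⟨ihB, ihW⟩ := ih (by omega)
      have htm : (t : ℝ) + 1 ≤ m := by exact_mod_cast ht
      have ht0 : (0 : ℝ) ≤ t := by positivity
      set Q := R ^ t * B0 with hQ
      have hQ0 : 0 ≤ Q := by positivity
      have htq : t * q ≤ 1 / 2 := by nlinarith
      have hq1 : q ≤ 1 / 2 := by nlinarith
      have hBQ : B t ≤ Q := ihB.trans (by nlinarith [mul_nonneg (mul_nonneg ht0 hq0) hQ0])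
      have hexp : Real.exp (t * (2 * p + 2 * k)) ≤ 4 := by
        have h4 : (4 : ℝ) = Real.exp (Real.log 2 + Real.log 2) := by
          rw [Real.exp_add, Real.exp_log (by norm_num)]; norm_num
        rw [h4, Real.exp_le_exp]
        have : t * p ≤ m * p := by nlinarith
        have : t * k ≤ 1 / 80 := by nlinarith
        nlinarith
      have hWQ : W t ≤ 7 * Q := by nlinarith
      have hRQ : R ^ (t + 1) * B0 = R * Q := by rw [hQ]; ring
      rw [hRQ]
      refine ⟨(hB t (by omega)).trans ?_, ?_⟩
      · have h1 : (1 - q) ^ 2 * B t + k * (2 * B t + 2 * W t)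
            ≤ ((1 - q) ^ 2 * (1 - t * q / 2) + 16 * k) * Q := by
          have e1 : (1 - q) ^ 2 * B t ≤ (1 - q) ^ 2 * ((1 - t * q / 2) * Q) :=
            mul_le_mul_of_nonneg_left ihB (sq_nonneg _)
          have e2 : k * (2 * B t + 2 * W t) ≤ k * (16 * Q) :=
            mul_le_mul_of_nonneg_left (by linarith) hk0
          linarith
        have h2 : (1 - q) ^ 2 * (1 - t * q / 2) + 16 * k ≤ 1 - (t + 1) * q / 2 := by
          -- the decrease `(2 q - q ^ 2) (1 - t q / 2)` is at least `9 q / 8`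
          have e1 : 3 / 2 * q ≤ 2 * q - q ^ 2 := by nlinarith
          have e2 : 3 / 2 * q * (3 / 4) ≤ (2 * q - q ^ 2) * (1 - t * q / 2) :=
            mul_le_mul e1 (by linarith) (by norm_num) (by nlinarith)
          nlinarith
        calc R * ((1 - q) ^ 2 * B t + k * (2 * B t + 2 * W t))
            ≤ R * ((1 - (t + 1) * q / 2) * Q) :=
              mul_le_mul_of_nonneg_left
                (h1.trans (mul_le_mul_of_nonneg_right h2 hQ0)) hR.le
          _ = _ := by push_cast; ring
      · have h1 : (1 + p) ^ 2 * W t + k * (2 * B t + 2 * W t) + Q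
            ≤ ((1 + p) ^ 2 + 2 * k) * (W t + Q) := by
          nlinarith [mul_le_mul_of_nonneg_left hBQ hk0, mul_nonneg hp0 hQ0,
            mul_nonneg (sq_nonneg p) hQ0]
        have h2 : (1 + p) ^ 2 + 2 * k ≤ Real.exp (2 * p + 2 * k) := by
          have e1 : (1 + p) ^ 2 ≤ Real.exp (2 * p) := by
            have := Real.add_one_le_exp p
            have e : Real.exp (2 * p) = Real.exp p ^ 2 := by
              rw [← Real.exp_nat_mul]; norm_num
            rw [e]
            gcongr
            linarith
          have e2 := Real.add_one_le_exp (2 * k)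
          rw [Real.exp_add]
          have e3 : 1 ≤ Real.exp (2 * p) := Real.one_le_exp (by linarith)
          nlinarith
        have h3 : 0 ≤ Real.exp (t * (2 * p + 2 * k)) * Q := by positivity
        calc W (t + 1) + R * Q
            ≤ R * ((1 + p) ^ 2 * W t + k * (2 * B t + 2 * W t) + Q) := by
              have := hW t (by omega); linarith
          _ ≤ R * (((1 + p) ^ 2 + 2 * k) * (W t + Q)) := by gcongr
          _ ≤ R * (((1 + p) ^ 2 + 2 * k) * (2 * Real.exp (t * (2 * p + 2 * k)) * Q)) := by
              gcongr
          _ ≤ R * (Real.exp (2 * p + 2 * k) * (2 * Real.exp (t * (2 * p + 2 * k)) * Q)) := by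
              gcongr
          _ = 2 * Real.exp ((t + 1 : ℕ) * (2 * p + 2 * k)) * (R * Q) := by
              have : Real.exp ((t + 1 : ℕ) * (2 * p + 2 * k))
                  = Real.exp (2 * p + 2 * k) * Real.exp (t * (2 * p + 2 * k)) := by
                rw [← Real.exp_add]; push_cast; ring_nf
              rw [this]; ring
  have := (key m le_rfl).1
  exact this

/-! ### Homogeneity of the gradients -/

lemma gradient_smul_of_scaling {g : E d → ℝ} {c r : ℝ} (hc : c ≠ 0) {b : ℝ}
    (hg : ∀ x : E d, x ≠ 0 → g (c • x) = r * g x + b) {x : E d} (hx : x ≠ 0) :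
    gradient g (c • x) = (r / c) • gradient g x := by
  have h1 : fderiv ℝ (fun y => g (c • y)) x = r • fderiv ℝ g x := by
    have : (fun y => g (c • y)) =ᶠ[nhds x] fun y => r * g y + b := by
      filter_upwards [isOpen_ne.mem_nhds hx] with y hy using hg y hy
    rw [this.fderiv_eq, fderiv_add_const]
    exact congrFun (fderiv_const_smul_field (f := g) r) x
  have h2 := fderiv_comp_smul (𝕜 := ℝ) (f := g) (x := x) c
  rw [h1] at h2
  have h3 : fderiv ℝ g (c • x) = (r / c) • fderiv ℝ g x := by
    rw [div_eq_inv_mul, mul_smul, h2, smul_smul, inv_mul_cancel₀ hc, one_smul]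
  simp only [gradient, h3, map_smulₛₗ]
  simp

/-- Both kinds of scale invariance take the form `f_i (c x) = |c| ^ p f_i x + b`. -/
lemma ScaleInvariantFamily.exists_const {p : ℝ} {f : Fin n → E d → ℝ}
    (hf : ScaleInvariantFamily p f) {c : ℝ} (hc : c ≠ 0) :
    ∃ b, ∀ i, ∀ x : E d, x ≠ 0 → f i (c • x) = |c| ^ p * f i x + b := by
  rcases hf with hf | ⟨rfl, a, _, _, hf⟩
  · exact ⟨0, fun i x hx => by rw [hf i c hc x hx, add_zero]⟩
  · exact ⟨_, fun i x hx => by rw [hf i c hc x hx, Real.rpow_zero, one_mul]⟩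

lemma ScaleInvariantFamily.gradient_smul {p : ℝ} {f : Fin n → E d → ℝ}
    (hf : ScaleInvariantFamily p f) (i : Fin n) {c : ℝ} (hc : c ≠ 0) {x : E d} (hx : x ≠ 0) :
    gradient (f i) (c • x) = (|c| ^ p / c) • gradient (f i) x := by
  obtain ⟨b, hb⟩ := hf.exists_const hc
  exact gradient_smul_of_scaling hc (hb i) hx

lemma ScaleInvariantFamily.gradient_avg_smul {p : ℝ} {f : Fin n → E d → ℝ}
    (hf : ScaleInvariantFamily p f) {c : ℝ} (hc : c ≠ 0) {x : E d} (hx : x ≠ 0) :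
    gradient (avg f) (c • x) = (|c| ^ p / c) • gradient (avg f) x := by
  obtain ⟨b, hb⟩ := hf.exists_const hc
  refine gradient_smul_of_scaling (b := n * b / n) hc (fun y hy => ?_) hx
  simp only [avg, fun i => hb i y hy, Finset.sum_add_distrib, ← Finset.mul_sum]
  simp
  ring

lemma gradient_smul_of_pos {p : ℝ} {g : E d → ℝ}
    (hg : ∀ c : ℝ, c ≠ 0 → ∀ x : E d, x ≠ 0 → gradient g (c • x) = (|c| ^ p / c) • gradient g x)
    {c : ℝ} (hc : 0 < c) {x : E d} (hx : x ≠ 0) :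
    gradient g (c • x) = c ^ (p - 1) • gradient g x := by
  rw [hg c hc.ne' x hx, abs_of_pos hc, Real.rpow_sub_one hc.ne']

/-- A gradient that is positively homogeneous of degree `p - 1` and odd, and continuous at the
origin, obeys the homogeneity relation with the factor `0` as well. -/
lemma rpow_smul_gradient_zero {p : ℝ} {g : E d → ℝ}
    (hg : ∀ c : ℝ, c ≠ 0 → ∀ x : E d, x ≠ 0 → gradient g (c • x) = (|c| ^ p / c) • gradient g x)
    (hcont : ContinuousAt (gradient g) 0) {x : E d} (hx : x ≠ 0) :
    (0 : ℝ) ^ (p - 1) • gradient g x = gradient g 0 := by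
  have hlim : ∀ z : E d, Filter.Tendsto (fun c : ℝ => gradient g (c • z)) (nhdsWithin 0 (Set.Ioi 0))
      (nhds (gradient g 0)) := by
    intro z
    have h1 : Filter.Tendsto (fun c : ℝ => c • z) (nhdsWithin 0 (Set.Ioi 0)) (nhds 0) := by
      have : Continuous fun c : ℝ => c • z := by fun_prop
      simpa using (this.tendsto 0).mono_left nhdsWithin_le_nhds
    exact hcont.tendsto.comp h1
  have hodd : ∀ z : E d, z ≠ 0 → gradient g (-z) = - gradient g z := by
    intro z hz
    have := hg (-1) (by norm_num) z hz
    simpa using this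
  have h0 : gradient g 0 = 0 := by
    have h1 := (hlim x).neg
    have h2 : Filter.Tendsto (fun c : ℝ => - gradient g (c • x)) (nhdsWithin 0 (Set.Ioi 0))
        (nhds (gradient g 0)) := by
      refine (hlim (-x)).congr' ?_
      filter_upwards [self_mem_nhdsWithin] with c hc
      rw [smul_neg, hodd _ (smul_ne_zero (ne_of_gt hc) hx)]
    have h3 := tendsto_nhds_unique h1 h2
    have h4 : (2 : ℝ) • gradient g 0 = 0 := by
      rw [two_smul]
      nth_rewrite 1 [← h3]
      simp
    simpa using h4
  rcases eq_or_ne p 1 with rfl | hp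
  · have h1 : Filter.Tendsto (fun c : ℝ => gradient g (c • x)) (nhdsWithin 0 (Set.Ioi 0))
        (nhds (gradient g x)) := by
      refine tendsto_const_nhds.congr' ?_
      filter_upwards [self_mem_nhdsWithin] with c hc
      rw [gradient_smul_of_pos hg hc hx]
      simp
    rw [tendsto_nhds_unique h1 (hlim x), h0, smul_zero]
  · rw [Real.zero_rpow (sub_ne_zero.2 hp), zero_smul, h0]

/-! ### Gradients, Hessians and the constants `K` and `L` -/

lemma contDiffOn_gradient {g : E d → ℝ} {U : Set (E d)} (hU : IsOpen U) {k l : WithTop ℕ∞}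
    (hg : ContDiffOn ℝ l g U) (hkl : k + 1 ≤ l) : ContDiffOn ℝ k (gradient g) U :=
  (InnerProductSpace.toDual ℝ (E d)).symm.contDiff.comp_contDiffOn
    (hg.fderiv_of_isOpen hU hkl)

lemma contDiffOn_gradCoord {g : E d → ℝ} {U : Set (E d)} (hU : IsOpen U) {k l : WithTop ℕ∞}
    (hg : ContDiffOn ℝ l g U) (hkl : k + 1 ≤ l) (j : Fin d) :
    ContDiffOn ℝ k (gradCoord g j) U :=
  (EuclideanSpace.proj (𝕜 := ℝ) j).contDiff.comp_contDiffOn (contDiffOn_gradient hU hg hkl)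

lemma hasFDerivAt_gradient {g : E d → ℝ} {U : Set (E d)} (hU : IsOpen U)
    (hg : ContDiffOn ℝ 2 g U) {x : E d} (hx : x ∈ U) :
    HasFDerivAt (gradient g) (hessian g x) x :=
  ((contDiffOn_gradient (k := 1) hU hg (by norm_num)).differentiableOn (by norm_num)
    |>.differentiableAt (hU.mem_nhds hx)).hasFDerivAt

lemma continuousOn_hessian {g : E d → ℝ} {U : Set (E d)} (hU : IsOpen U)
    (hg : ContDiffOn ℝ 2 g U) : ContinuousOn (hessian g) U :=
  (contDiffOn_gradient (k := 1) hU hg (by norm_num)).continuousOn_fderiv_of_isOpen hU (by norm_num)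

lemma hessian_apply_coord {g : E d → ℝ} {U : Set (E d)} (hU : IsOpen U)
    (hg : ContDiffOn ℝ 2 g U) {x : E d} (hx : x ∈ U) (h : E d) (j : Fin d) :
    (hessian g x h) j = ⟪gradient (gradCoord g j) x, h⟫ := by
  have h1 : HasFDerivAt (gradCoord g j)
      ((EuclideanSpace.proj (𝕜 := ℝ) j).comp (hessian g x)) x :=
    (EuclideanSpace.proj (𝕜 := ℝ) j).hasFDerivAt.comp x (hasFDerivAt_gradient hU hg hx)
  rw [inner_gradient_left, h1.fderiv]
  simp

lemma hasDerivAt_of_coord {φ : ℝ → E d} {φ' : E d} {t : ℝ}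
    (h : ∀ j, HasDerivAt (fun s => φ s j) (φ' j) t) : HasDerivAt φ φ' t := by
  let L := (PiLp.continuousLinearEquiv 2 ℝ (fun _ : Fin d => ℝ)).symm
  exact (L : (Fin d → ℝ) →L[ℝ] E d).hasFDerivAt.comp_hasDerivAt t (hasDerivAt_pi.2 h)

/-- Second order Taylor estimate for the gradient along a segment, with a quadratic correction
`(c / 2) t ^ 2 w`. -/
lemma norm_gradient_taylor_le {g : E d → ℝ} {U : Set (E d)} (hU : IsOpen U)
    (hg : ContDiffOn ℝ 3 g U) {a h w : E d} {c C : ℝ}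
    (hseg : ∀ t ∈ Set.Icc (0 : ℝ) 1, a + t • h ∈ U)
    (hC : ∀ t ∈ Set.Icc (0 : ℝ) 1,
      ‖(WithLp.toLp 2 fun j => ⟪h, hessian (gradCoord g j) (a + t • h) h⟫ : E d) + c • w‖ ≤ C) :
    ‖gradient g (a + h) - gradient g a - hessian g a h + (c / 2) • w‖ ≤ C / 2 := by
  have hg2 : ContDiffOn ℝ 2 g U := hg.of_le (by norm_num)
  have hline : ∀ t : ℝ, HasDerivAt (fun t : ℝ => a + t • h) h t := fun t => by
    simpa using ((hasDerivAt_id t).smul_const h).const_add a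
  have h1 : ∀ t ∈ Set.Icc (0 : ℝ) 1,
      HasDerivAt (fun t : ℝ => gradient g (a + t • h) + (c * t ^ 2 / 2) • w)
        (hessian g (a + t • h) h + (c * t) • w) t := by
    intro t ht
    have e1 := (hasFDerivAt_gradient hU hg2 (hseg t ht)).comp_hasDerivAt t (hline t)
    have e2 : HasDerivAt (fun t => c * t ^ 2 / 2) (c * t) t := by
      refine (((hasDerivAt_pow 2 t).const_mul c).div_const 2).congr_deriv ?_
      push_cast
      ring
    exact e1.add (e2.smul_const w)
  have h2 : ∀ t ∈ Set.Icc (0 : ℝ) 1,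
      HasDerivAt (fun t : ℝ => hessian g (a + t • h) h + (c * t) • w)
        ((WithLp.toLp 2 fun j => ⟪h, hessian (gradCoord g j) (a + t • h) h⟫ : E d) + c • w) t := by
    intro t ht
    have e2 : HasDerivAt (fun t => (c * t) • w) (c • w) t := by
      simpa using ((hasDerivAt_id t).const_mul c).smul_const w
    refine HasDerivAt.add (hasDerivAt_of_coord fun j => ?_) e2
    have e3 := (hasFDerivAt_gradient hU (contDiffOn_gradCoord (k := 2) hU hg (by norm_num) j)
      (hseg t ht)).comp_hasDerivAt t (hline t)
    have e4 := e3.inner ℝ (hasDerivAt_const t h)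
    have e5 : (fun s : ℝ => (hessian g (a + s • h) h) j) =ᶠ[nhds t]
        fun s => ⟪gradient (gradCoord g j) (a + s • h), h⟫ := by
      have : ∀ᶠ s in nhds t, a + s • h ∈ U :=
        (hline t).continuousAt.eventually_mem (hU.mem_nhds (hseg t ht))
      filter_upwards [this] with s hs using hessian_apply_coord hU hg2 hs h j
    refine HasDerivAt.congr_of_eventuallyEq ?_ e5
    refine e4.congr_deriv ?_
    simp [real_inner_comm]
  have key := norm_sub_sub_le_half_of_deriv_two h1 h2 hC
  refine (le_of_eq (congrArg _ ?_)).trans key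
  simp only [one_smul, zero_smul, add_zero]
  module

/-- The mean value inequality for the gradient, with the Hessian bounded along the segment. -/
lemma norm_gradient_sub_le {g : E d → ℝ} {U D : Set (E d)} (hU : IsOpen U)
    (hg : ContDiffOn ℝ 2 g U) {C : ℝ} {w y : E d} (hDU : D ⊆ U) (hseg : segment ℝ y w ⊆ D)
    (hC : ∀ z ∈ D, ‖hessian g z‖ ≤ C) :
    ‖gradient g y - gradient g w‖ ≤ C * ‖y - w‖ :=
  Convex.norm_image_sub_le_of_norm_hasFDerivWithin_le
    (fun _ hz => (hasFDerivAt_gradient hU hg (hDU (hseg hz))).hasFDerivWithinAt)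
    (fun _ hz => hC _ (hseg hz)) (convex_segment y w) (right_mem_segment ℝ y w)
    (left_mem_segment ℝ y w)

/-- The mean value inequality in the mean square over a finite family: the intermediate point
need not depend on the member of the family, because it is applied to the stacked gradients. -/
lemma sum_norm_gradient_sub_sq_le {ι : Type*} [Fintype ι] {g : ι → E d → ℝ} {U D : Set (E d)}
    (hU : IsOpen U) (hg : ∀ i, ContDiffOn ℝ 2 (g i) U) {C : ℝ} {w y : E d} (hDU : D ⊆ U)
    (hseg : segment ℝ y w ⊆ D) (hC : ∀ z ∈ D, ∑ i, ‖hessian (g i) z‖ ^ 2 ≤ C) :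
    ∑ i, ‖gradient (g i) y - gradient (g i) w‖ ^ 2 ≤ C * ‖y - w‖ ^ 2 := by
  let L : (ι → E d) ≃L[ℝ] PiLp 2 (fun _ : ι => E d) :=
    (PiLp.continuousLinearEquiv 2 ℝ (fun _ : ι => E d)).symm
  have hC0 : 0 ≤ C :=
    (Finset.sum_nonneg fun i _ => sq_nonneg _).trans (hC y (hseg (left_mem_segment ℝ y w)))
  have h := Convex.norm_image_sub_le_of_norm_hasFDerivWithin_le
    (f := fun z => L fun i => gradient (g i) z)
    (f' := fun z => (L : (ι → E d) →L[ℝ] _).comp (ContinuousLinearMap.pi fun i => hessian (g i) z))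
    (C := √C) (s := segment ℝ y w)
    (fun z hz => by
      refine (L.hasFDerivAt.comp z (hasFDerivAt_pi.2 fun i => ?_)).hasFDerivWithinAt
      exact hasFDerivAt_gradient hU (hg i) (hDU (hseg hz)))
    (fun z hz => by
      refine ContinuousLinearMap.opNorm_le_bound _ (Real.sqrt_nonneg _) fun u => ?_
      rw [PiLp.norm_eq_of_L2]
      refine Real.sqrt_le_iff.2 ⟨by positivity, ?_⟩
      rw [mul_pow, Real.sq_sqrt hC0]
      refine le_trans ?_ (mul_le_mul_of_nonneg_right (hC z (hseg hz)) (sq_nonneg ‖u‖))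
      rw [Finset.sum_mul]
      refine Finset.sum_le_sum fun i _ => ?_
      rw [← mul_pow]
      exact pow_le_pow_left₀ (norm_nonneg _) ((hessian (g i) z).le_opNorm u) 2)
    (convex_segment y w) (right_mem_segment ℝ y w) (left_mem_segment ℝ y w)
  have h2 := pow_le_pow_left₀ (norm_nonneg _) h 2
  rw [mul_pow, Real.sq_sqrt hC0, PiLp.norm_sq_eq_of_L2] at h2
  exact h2

lemma contDiffOn_avg {f : Fin n → E d → ℝ} {U : Set (E d)} {k : WithTop ℕ∞}
    (hf : ∀ i, ContDiffOn ℝ k (f i) U) : ContDiffOn ℝ k (avg f) U :=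
  (ContDiffOn.sum fun i _ => hf i).div_const _

lemma contDiffOn_batch {f : Fin n → E d → ℝ} {U : Set (E d)} {k : WithTop ℕ∞}
    (hf : ∀ i, ContDiffOn ℝ k (f i) U) (S : Finset (Fin n)) : ContDiffOn ℝ k (batch f S) U :=
  (ContDiffOn.sum fun i _ => hf i).div_const _

/-- The deviation `g_S = f_S - f` of a mini-batch from the average. -/
noncomputable def dev (f : Fin n → E d → ℝ) (S : Finset (Fin n)) (x : E d) : ℝ := batch f S x - avg f x

lemma contDiffOn_dev {f : Fin n → E d → ℝ} {U : Set (E d)} {k : WithTop ℕ∞}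
    (hf : ∀ i, ContDiffOn ℝ k (f i) U) (S : Finset (Fin n)) : ContDiffOn ℝ k (dev f S) U :=
  (contDiffOn_batch hf S).sub (contDiffOn_avg hf)

lemma gradient_avg {f : Fin n → E d → ℝ} {x : E d} (hf : ∀ i, DifferentiableAt ℝ (f i) x) :
    gradient (avg f) x = (n : ℝ)⁻¹ • ∑ i, gradient (f i) x := by
  have h : HasGradientAt (avg f) ((n : ℝ)⁻¹ • ∑ i, gradient (f i) x) x := by
    rw [hasGradientAt_iff_hasFDerivAt, map_smul, map_sum]
    have := (HasFDerivAt.fun_sum (u := Finset.univ) fun i _ =>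
      (hf i).hasGradientAt.hasFDerivAt).const_mul (n : ℝ)⁻¹
    refine this.congr_of_eventuallyEq (Filter.Eventually.of_forall fun y => ?_)
    simp [avg, div_eq_inv_mul]
  exact h.gradient

lemma gradient_batch {f : Fin n → E d → ℝ} {x : E d} (hf : ∀ i, DifferentiableAt ℝ (f i) x)
    (S : Finset (Fin n)) :
    gradient (batch f S) x = (S.card : ℝ)⁻¹ • ∑ i ∈ S, gradient (f i) x := by
  have h : HasGradientAt (batch f S) ((S.card : ℝ)⁻¹ • ∑ i ∈ S, gradient (f i) x) x := by
    rw [hasGradientAt_iff_hasFDerivAt, map_smul, map_sum]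
    have := (HasFDerivAt.fun_sum (u := S) fun i _ =>
      (hf i).hasGradientAt.hasFDerivAt).const_mul (S.card : ℝ)⁻¹
    refine this.congr_of_eventuallyEq (Filter.Eventually.of_forall fun y => ?_)
    simp [batch, div_eq_inv_mul]
  exact h.gradient

lemma gradient_dev {f : Fin n → E d → ℝ} {x : E d} (hf : ∀ i, DifferentiableAt ℝ (f i) x)
    (S : Finset (Fin n)) :
    gradient (dev f S) x = gradient (batch f S) x - gradient (avg f) x := by
  have h1 : DifferentiableAt ℝ (batch f S) x := by
    change DifferentiableAt ℝ (fun x => (∑ l ∈ S, f l x) / S.card) x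
    simp only [div_eq_mul_inv]
    exact (DifferentiableAt.fun_sum fun i _ => hf i).mul_const _
  have h2 : DifferentiableAt ℝ (avg f) x := by
    change DifferentiableAt ℝ (fun x => (∑ l, f l x) / n) x
    simp only [div_eq_mul_inv]
    exact (DifferentiableAt.fun_sum fun i _ => hf i).mul_const _
  have h : HasGradientAt (dev f S) (gradient (batch f S) x - gradient (avg f) x) x := by
    rw [hasGradientAt_iff_hasFDerivAt, map_sub]
    exact h1.hasGradientAt.hasFDerivAt.sub h2.hasGradientAt.hasFDerivAt
  exact h.gradient

/-- With all the points equal, `G_S(x,…,x)` is the Hessian of `g_S` at `x`. -/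
lemma toEuclideanCLM_matG_const {f : Fin n → E d → ℝ} {U : Set (E d)} (hU : IsOpen U)
    (hf : ∀ i, ContDiffOn ℝ 2 (f i) U) (S : Finset (Fin n)) {x : E d} (hx : x ∈ U) :
    Matrix.toEuclideanCLM (𝕜 := ℝ) (n := Fin d) (matG f S fun _ => x) = hessian (dev f S) x := by
  ext u j
  rw [hessian_apply_coord hU (contDiffOn_dev hf S) hx, Matrix.ofLp_toEuclideanCLM]
  simp only [Matrix.mulVec, matG, Matrix.of_apply, dotProduct, PiLp.inner_apply,
    RCLike.inner_apply, conj_trivial]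
  exact Finset.sum_congr rfl fun k _ => mul_comm _ _

lemma norm_hessian_dev {f : Fin n → E d → ℝ} {U : Set (E d)} (hU : IsOpen U)
    (hf : ∀ i, ContDiffOn ℝ 2 (f i) U) (S : Finset (Fin n)) {x : E d} (hx : x ∈ U) :
    ‖hessian (dev f S) x‖ = normG f S fun _ => x := by
  rw [normG, toEuclideanCLM_matG_const hU hf S hx]

/-- The operator norm of `G_S(y)` is bounded on `D^d` because its entries are. -/
lemma exists_normG_le {f : Fin n → E d → ℝ} {U D : Set (E d)} (hU : IsOpen U)
    (hf : ∀ i, ContDiffOn ℝ 2 (f i) U) (hD : IsCompact D) (hDU : D ⊆ U) :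
    ∃ C, ∀ S (y : Fin d → E d), (∀ j, y j ∈ D) → normG f S y ≤ C := by
  have h1 : ∀ S : Finset (Fin n), ∀ j : Fin d, ∃ C, ∀ z ∈ D,
      ‖gradient (gradCoord (dev f S) j) z‖ ≤ C := by
    intro S j
    refine hD.exists_bound_of_continuousOn ?_
    have := contDiffOn_gradient (k := 0) hU
      (contDiffOn_gradCoord (k := 1) hU (contDiffOn_dev hf S) (by norm_num) j) (by norm_num)
    exact this.continuousOn.mono hDU
  choose C hC using h1
  have h2 : ∀ S (y : Fin d → E d), (∀ j, y j ∈ D) → normG f S y ≤ √(∑ j, C S j ^ 2) := by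
    intro S y hy
    refine ContinuousLinearMap.opNorm_le_bound _ (Real.sqrt_nonneg _) fun u => ?_
    rw [EuclideanSpace.norm_eq]
    refine Real.sqrt_le_iff.2 ⟨by positivity, ?_⟩
    rw [mul_pow, Real.sq_sqrt (by positivity), Finset.sum_mul]
    refine Finset.sum_le_sum fun j _ => ?_
    have e : (Matrix.toEuclideanCLM (𝕜 := ℝ) (n := Fin d) (matG f S y) u) j
        = ⟪gradient (gradCoord (dev f S) j) (y j), u⟫ := by
      rw [Matrix.ofLp_toEuclideanCLM]
      simp only [Matrix.mulVec, matG, Matrix.of_apply, dotProduct, PiLp.inner_apply,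
        RCLike.inner_apply, conj_trivial]
      exact Finset.sum_congr rfl fun k _ => mul_comm _ _
    rw [e, ← mul_pow, Real.norm_eq_abs]
    refine pow_le_pow_left₀ (abs_nonneg _) ((abs_real_inner_le_norm _ _).trans ?_) 2
    exact mul_le_mul_of_nonneg_right (hC S j _ (hy j)) (norm_nonneg _)
  refine ⟨∑ S, √(∑ j, C S j ^ 2), fun S y hy => (h2 S y hy).trans ?_⟩
  exact Finset.single_le_sum (f := fun S => √(∑ j, C S j ^ 2))
    (fun S _ => Real.sqrt_nonneg _) (Finset.mem_univ S)

lemma normG_sq_le_constL {f : Fin n → E d → ℝ} {U D : Set (E d)} (hU : IsOpen U)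
    (hf : ∀ i, ContDiffOn ℝ 2 (f i) U) (hD : IsCompact D) (hDU : D ⊆ U) {s : ℕ}
    {S : Finset (Fin n)} (hS : S ∈ batches n s) {y : Fin d → E d} (hy : ∀ j, y j ∈ D) :
    normG f S y ^ 2 ≤ constL f s D := by
  obtain ⟨C, hC⟩ := exists_normG_le hU hf hD hDU
  refine le_csSup ⟨C ^ 2, ?_⟩ ⟨S, hS, y, hy, rfl⟩
  rintro r ⟨S, _, y, hy, rfl⟩
  exact pow_le_pow_left₀ (norm_nonneg _) (hC S y hy) 2

lemma sum_normG_sq_le_constK {f : Fin n → E d → ℝ} {U D : Set (E d)} (hU : IsOpen U)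
    (hf : ∀ i, ContDiffOn ℝ 2 (f i) U) (hD : IsCompact D) (hDU : D ⊆ U) {s : ℕ}
    {y : Fin d → E d} (hy : ∀ j, y j ∈ D) :
    (∑ S ∈ batches n s, normG f S y ^ 2) / (batches n s).card ≤ constK f s D := by
  obtain ⟨C, hC⟩ := exists_normG_le hU hf hD hDU
  refine le_csSup ⟨(∑ S ∈ batches n s, C ^ 2) / (batches n s).card, ?_⟩ ⟨y, hy, rfl⟩
  rintro r ⟨y, hy, rfl⟩
  gcongr with S _
  · exact norm_nonneg _
  · exact hC S y hy

lemma constL_nonneg (f : Fin n → E d → ℝ) (s : ℕ) (D : Set (E d)) : 0 ≤ constL f s D :=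
  Real.sSup_nonneg (by rintro r ⟨S, _, y, _, rfl⟩; positivity)

lemma constK_nonneg (f : Fin n → E d → ℝ) (s : ℕ) (D : Set (E d)) : 0 ≤ constK f s D :=
  Real.sSup_nonneg (by rintro r ⟨y, _, rfl⟩; positivity)

lemma matG_eq_smul_sum_singleton {f : Fin n → E d → ℝ} {U : Set (E d)} (hU : IsOpen U)
    (hf : ∀ i, ContDiffOn ℝ 2 (f i) U) {S : Finset (Fin n)} (hS : S.Nonempty)
    {y : Fin d → E d} (hy : ∀ j, y j ∈ U) :
    matG f S y = (S.card : ℝ)⁻¹ • ∑ l ∈ S, matG f {l} y := by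
  have hc : (S.card : ℝ) ≠ 0 := by exact_mod_cast hS.card_pos.ne'
  have hdiff : ∀ z ∈ U, ∀ i, DifferentiableAt ℝ (f i) z := fun z hz i =>
    ((hf i).differentiableOn (by norm_num)).differentiableAt (hU.mem_nhds hz)
  have h1 : ∀ z ∈ U, gradient (dev f S) z = (S.card : ℝ)⁻¹ • ∑ l ∈ S, gradient (dev f {l}) z := by
    intro z hz
    simp only [gradient_dev (hdiff z hz), gradient_batch (hdiff z hz), Finset.sum_sub_distrib,
      Finset.card_singleton, Finset.sum_singleton, Finset.sum_const, smul_sub]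
    congr 1
    · simp
    · rw [← Nat.cast_smul_eq_nsmul ℝ, smul_smul, inv_mul_cancel₀ hc, one_smul]
  have h2 : ∀ j, gradient (gradCoord (dev f S) j) (y j)
      = (S.card : ℝ)⁻¹ • ∑ l ∈ S, gradient (gradCoord (dev f {l}) j) (y j) := by
    intro j
    have hd : ∀ l, DifferentiableAt ℝ (gradCoord (dev f {l}) j) (y j) := fun l =>
      ((contDiffOn_gradCoord (k := 1) hU (contDiffOn_dev hf {l}) (by norm_num) j).differentiableOn
        (by norm_num)).differentiableAt (hU.mem_nhds (hy j))
    have : HasGradientAt (gradCoord (dev f S) j)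
        ((S.card : ℝ)⁻¹ • ∑ l ∈ S, gradient (gradCoord (dev f {l}) j) (y j)) (y j) := by
      rw [hasGradientAt_iff_hasFDerivAt, map_smul, map_sum]
      have := (HasFDerivAt.fun_sum (u := S) fun l _ =>
        (hd l).hasGradientAt.hasFDerivAt).const_mul (S.card : ℝ)⁻¹
      refine this.congr_of_eventuallyEq ?_
      filter_upwards [hU.mem_nhds (hy j)] with z hz
      simp [gradCoord, h1 z hz]
    exact this.gradient
  ext j k
  have := congrArg (fun u : E d => u k) (h2 j)
  unfold dev at this
  simpa [matG, Matrix.sum_apply, dev] using this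

/-- `G_S` is the mean of the `G_{{l}}` over `l ∈ S`, so its norm is largest for singletons. -/
lemma constL_le_constL_one {f : Fin n → E d → ℝ} {U D : Set (E d)} (hU : IsOpen U)
    (hf : ∀ i, ContDiffOn ℝ 2 (f i) U) (hD : IsCompact D) (hDU : D ⊆ U) {s : ℕ} (hs : 1 ≤ s) :
    constL f s D ≤ constL f 1 D := by
  refine Real.sSup_le ?_ (constL_nonneg f 1 D)
  rintro r ⟨S, hS, y, hy, rfl⟩
  have hcard : S.card = s := (Finset.mem_powersetCard.1 hS).2
  have hne : S.Nonempty := Finset.card_pos.1 (by omega)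
  have hc : (0 : ℝ) < S.card := by exact_mod_cast hne.card_pos
  have h1 : ∀ l ∈ S, normG f {l} y ≤ √(constL f 1 D) := fun l _ =>
    Real.le_sqrt_of_sq_le (normG_sq_le_constL hU hf hD hDU
      (Finset.mem_powersetCard.2 ⟨Finset.subset_univ _, Finset.card_singleton l⟩) hy)
  have h2 : normG f S y ≤ √(constL f 1 D) := by
    rw [normG, matG_eq_smul_sum_singleton hU hf hne fun j => hDU (hy j), map_smul, map_sum,
      norm_smul, Real.norm_eq_abs, abs_of_pos (inv_pos.2 hc), inv_mul_le_iff₀ hc]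
    refine (norm_sum_le _ _).trans ?_
    calc ∑ l ∈ S, ‖Matrix.toEuclideanCLM (𝕜 := ℝ) (n := Fin d) (matG f {l} y)‖
        ≤ ∑ l ∈ S, √(constL f 1 D) := Finset.sum_le_sum h1
      _ = _ := by simp
  have h3 := pow_le_pow_left₀ (norm_nonneg _) h2 2
  rwa [Real.sq_sqrt (constL_nonneg f 1 D)] at h3

/-! ### The gradient near the maximizer and the mini-batch noise -/

lemma norm_sub_sq_of_unit {y z : E d} (hy : ‖y‖ = 1) (hz : ‖z‖ = 1) :
    ‖y - z‖ ^ 2 = 2 * (1 - ⟪y, z⟫) := by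
  rw [norm_sub_sq_real, hy, hz]; ring

lemma exists_hessian_gradCoord_le {g : E d → ℝ} {U D : Set (E d)} (hU : IsOpen U)
    (hg : ContDiffOn ℝ 3 g U) (hD : IsCompact D) (hDU : D ⊆ U) :
    ∃ C, ∀ j, ∀ z ∈ D, ‖hessian (gradCoord g j) z‖ ≤ C := by
  have h1 : ∀ j : Fin d, ∃ C, ∀ z ∈ D, ‖hessian (gradCoord g j) z‖ ≤ C := fun j =>
    hD.exists_bound_of_continuousOn ((continuousOn_hessian hU
      (contDiffOn_gradCoord (k := 2) hU hg (by norm_num) j)).mono hDU)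
  choose C hC using h1
  refine ⟨∑ j, |C j|, fun j z hz => (hC j z hz).trans ((le_abs_self _).trans ?_)⟩
  exact Finset.single_le_sum (f := fun j => |C j|) (fun j _ => abs_nonneg _) (Finset.mem_univ j)

/-- The vector with coordinates `hᵀ H_j(z) h`, the second derivative at `z` of the gradient of `g`
along `h`. -/
noncomputable def quadVec (g : E d → ℝ) (z h : E d) : E d :=
  WithLp.toLp 2 fun j => ⟪h, hessian (gradCoord g j) z h⟫

lemma quadVec_smul (g : E d → ℝ) (z h : E d) (c : ℝ) :
    quadVec g z (c • h) = c ^ 2 • quadVec g z h := by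
  ext j
  simp [quadVec, inner_smul_left, inner_smul_right]
  ring

/-- The quadratic forms of the `F_i` at equal points are the coordinates, in the basis `v`, of
`quadVec` with a correction along `v 0`. -/
lemma inner_quadVec_add [NeZero d] (g : E d → ℝ) (ls : ℝ) (lam : Fin d → ℝ)
    (v : OrthonormalBasis (Fin d) ℝ (E d)) (z h : E d) (i : Fin d) :
    ⟪v i, quadVec g z h + ((ls - lam 0) * ‖h‖ ^ 2) • v 0⟫
      = ⟪h, opF g ls lam v i (fun _ => z) h⟫ := by
  have h0 : ⟪v i, v 0⟫ = if i = 0 then (1 : ℝ) else 0 := by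
    rw [orthonormal_iff_ite.1 v.orthonormal]
  simp only [opF, inner_add_right, inner_smul_right, h0, _root_.add_apply,
    _root_.smul_apply, _root_.sum_apply, inner_sum,
    ContinuousLinearMap.id_apply, real_inner_self_eq_norm_sq]
  rw [add_comm]
  congr 1
  · split_ifs <;> simp
  · simp only [quadVec, PiLp.inner_apply, RCLike.inner_apply, conj_trivial]
    exact Finset.sum_congr rfl fun j _ => mul_comm _ _

lemma constM2_nonneg (g : E d → ℝ) (D : Set (E d)) : 0 ≤ constM2 g D :=
  Real.sSup_nonneg (by rintro r ⟨x, z, y, _, _, _, rfl⟩; positivity)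

lemma abs_inner_clm_le {x : E d} (hx : ‖x‖ = 1) (A : E d →L[ℝ] E d) : |⟪x, A x⟫| ≤ ‖A‖ := by
  refine (abs_real_inner_le_norm _ _).trans ?_
  have := A.le_opNorm x
  rw [hx] at *
  linarith

lemma norm_quadVec_add_le [NeZero d] {g : E d → ℝ} {U D : Set (E d)} (hU : IsOpen U)
    (hg : ContDiffOn ℝ 3 g U) (hD : IsCompact D) (hDU : D ⊆ U) (ls : ℝ) (lam : Fin d → ℝ)
    (v : OrthonormalBasis (Fin d) ℝ (E d)) {z : E d} (hz : z ∈ D) (h : E d) :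
    ‖quadVec g z h + ((ls - lam 0) * ‖h‖ ^ 2) • v 0‖ ≤ constM1 g ls lam v D * ‖h‖ ^ 2 := by
  obtain ⟨C, hC⟩ := exists_hessian_gradCoord_le hU hg hD hDU
  have hbdd : BddAbove {r | ∃ (x : E d) (y : Fin d → E d), ‖x‖ = 1 ∧ (∀ j, y j ∈ D) ∧
      r = √(∑ i, ⟪x, opF g ls lam v i y x⟫ ^ 2)} := by
    refine ⟨√(∑ i : Fin d, (|ls - lam 0| + ∑ j, ‖v i j‖ * C) ^ 2), ?_⟩
    rintro r ⟨x, y, hx, hy, rfl⟩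
    refine Real.sqrt_le_sqrt (Finset.sum_le_sum fun i _ => ?_)
    rw [← sq_abs]
    refine pow_le_pow_left₀ (abs_nonneg _) ((abs_inner_clm_le hx _).trans ?_) 2
    refine (norm_add_le _ _).trans (add_le_add ?_ ?_)
    · rw [norm_smul]
      refine (mul_le_mul_of_nonneg_left ContinuousLinearMap.norm_id_le (norm_nonneg _)).trans ?_
      split_ifs <;> simp
    · refine (norm_sum_le _ _).trans (Finset.sum_le_sum fun j _ => ?_)
      rw [norm_smul]
      exact mul_le_mul_of_nonneg_left (hC j _ (hy j)) (norm_nonneg _)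
  rcases eq_or_ne h 0 with rfl | hne
  · have := quadVec_smul g z (0 : E d) 0
    simp at this
    simp [this]
  have hpos : 0 < ‖h‖ := norm_pos_iff.2 hne
  set x : E d := ‖h‖⁻¹ • h with hx
  have hx1 : ‖x‖ = 1 := by rw [hx, norm_smul, norm_inv, norm_norm, inv_mul_cancel₀ hpos.ne']
  have hhx : h = ‖h‖ • x := by rw [hx, smul_smul, mul_inv_cancel₀ hpos.ne', one_smul]
  have h1 : ‖quadVec g z x + ((ls - lam 0) * ‖x‖ ^ 2) • v 0‖ ≤ constM1 g ls lam v D := by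
    refine le_csSup hbdd ⟨x, fun _ => z, hx1, fun _ => hz, ?_⟩
    simp_rw [← inner_quadVec_add]
    rw [v.sum_sq_inner_right, Real.sqrt_sq (norm_nonneg _)]
  have h2 : quadVec g z h + ((ls - lam 0) * ‖h‖ ^ 2) • v 0
      = ‖h‖ ^ 2 • (quadVec g z x + ((ls - lam 0) * ‖x‖ ^ 2) • v 0) := by
    conv_lhs => rw [hhx, quadVec_smul, norm_smul, norm_norm]
    rw [hx1]
    module
  rw [h2, norm_smul, Real.norm_eq_abs, abs_of_nonneg (by positivity), mul_comm]
  gcongr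

lemma norm_quadVec_le {g : E d → ℝ} {U D : Set (E d)} (hU : IsOpen U)
    (hg : ContDiffOn ℝ 3 g U) (hD : IsCompact D) (hDU : D ⊆ U) {z : E d} (hz : z ∈ D) (h : E d) :
    ‖quadVec g z h‖ ≤ constM2 g D * ‖h‖ ^ 2 := by
  obtain ⟨C, hC⟩ := exists_hessian_gradCoord_le hU hg hD hDU
  have hbdd : BddAbove {r | ∃ (x z : E d) (y : Fin d → E d), ‖x‖ = 1 ∧ ‖z‖ = 1 ∧ (∀ j, y j ∈ D) ∧
      r = |∑ i, z i * ⟪x, hessian (gradCoord g i) (y i) x⟫|} := by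
    refine ⟨∑ i : Fin d, 1 * C, ?_⟩
    rintro r ⟨x, z, y, hx, hz, hy, rfl⟩
    refine (Finset.abs_sum_le_sum_abs _ _).trans (Finset.sum_le_sum fun i _ => ?_)
    rw [abs_mul]
    refine mul_le_mul ?_ ((abs_inner_clm_le hx _).trans (hC i _ (hy i))) (abs_nonneg _) zero_le_one
    rw [← hz]
    exact PiLp.norm_apply_le z i
  rcases eq_or_ne h 0 with rfl | hne
  · have := quadVec_smul g z (0 : E d) 0
    simp at this
    simp [this]
  have hpos : 0 < ‖h‖ := norm_pos_iff.2 hne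
  set x : E d := ‖h‖⁻¹ • h with hx
  have hx1 : ‖x‖ = 1 := by rw [hx, norm_smul, norm_inv, norm_norm, inv_mul_cancel₀ hpos.ne']
  have hhx : h = ‖h‖ • x := by rw [hx, smul_smul, mul_inv_cancel₀ hpos.ne', one_smul]
  have h1 : ‖quadVec g z x‖ ≤ constM2 g D := by
    rcases eq_or_ne (quadVec g z x) 0 with h0 | h0
    · rw [h0, norm_zero]; exact constM2_nonneg g D
    have hp : 0 < ‖quadVec g z x‖ := norm_pos_iff.2 h0
    refine le_csSup hbdd ⟨x, ‖quadVec g z x‖⁻¹ • quadVec g z x, fun _ => z, hx1, ?_,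
      fun _ => hz, ?_⟩
    · rw [norm_smul, norm_inv, norm_norm, inv_mul_cancel₀ hp.ne']
    · have e : ∑ i, (‖quadVec g z x‖⁻¹ • quadVec g z x) i * ⟪x, hessian (gradCoord g i) z x⟫
          = ⟪quadVec g z x, ‖quadVec g z x‖⁻¹ • quadVec g z x⟫ := by
        simp only [PiLp.inner_apply, RCLike.inner_apply, conj_trivial]
        rfl
      rw [e, inner_smul_right, real_inner_self_eq_norm_sq, sq, inv_mul_cancel_left₀ hp.ne',
        abs_of_pos hp]
  conv_lhs => rw [hhx, quadVec_smul]
  rw [norm_smul, Real.norm_eq_abs, abs_of_nonneg (by positivity), mul_comm]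
  gcongr

/-- The tail of `x`: its component orthogonal to the unit vector `e`. -/
noncomputable def tl (e x : E d) : E d := x - ⟪x, e⟫ • e

lemma inner_tl {e : E d} (he : ‖e‖ = 1) (x : E d) : ⟪tl e x, e⟫ = 0 := by
  rw [tl, inner_sub_left, inner_smul_left, real_inner_self_eq_norm_sq, he]
  simp

lemma norm_sq_eq_inner_sq_add {e : E d} (he : ‖e‖ = 1) (x : E d) :
    ‖x‖ ^ 2 = ⟪x, e⟫ ^ 2 + ‖tl e x‖ ^ 2 := by
  rw [tl, norm_sub_sq_real, inner_smul_right, norm_smul, he, Real.norm_eq_abs, mul_one, sq_abs]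
  ring

lemma tl_add (e x y : E d) : tl e (x + y) = tl e x + tl e y := by
  simp only [tl, inner_add_left]; module

lemma tl_smul (e : E d) (c : ℝ) (x : E d) : tl e (c • x) = c • tl e x := by
  simp only [tl, inner_smul_left, conj_trivial]; module

lemma norm_tl_le {e : E d} (he : ‖e‖ = 1) (x : E d) : ‖tl e x‖ ≤ ‖x‖ :=
  pow_le_pow_iff_left₀ (norm_nonneg _) (norm_nonneg _) two_ne_zero |>.1
    (by rw [norm_sq_eq_inner_sq_add he x]; nlinarith [sq_nonneg ⟪x, e⟫])

lemma tailSq_eq [NeZero d] (v : OrthonormalBasis (Fin d) ℝ (E d)) (x : E d) :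
    tailSq v x = ‖tl (v 0) x‖ ^ 2 := by
  have h1 := norm_sq_eq_inner_sq_add (v.orthonormal.1 0) x
  have h2 := v.sum_sq_inner_left x
  have h3 := Finset.sum_filter_add_sum_filter_not Finset.univ (fun k : Fin d => k ≠ 0)
    (fun k => ⟪x, v k⟫ ^ 2)
  have h4 : Finset.univ.filter (fun k : Fin d => ¬ k ≠ 0) = {0} := by
    ext k; simp
  rw [h4, Finset.sum_singleton] at h3
  rw [tailSq]
  linarith

section Eigen
variable {A : E d →L[ℝ] E d} {lam : Fin d → ℝ} {v : OrthonormalBasis (Fin d) ℝ (E d)}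

lemma inner_apply_of_eigenbasis (hv : ∀ i, A (v i) = lam i • v i) (i : Fin d) (u : E d) :
    ⟪v i, A u⟫ = lam i * ⟪v i, u⟫ := by
  have h : A u = ∑ j, (⟪v j, u⟫ * lam j) • v j := by
    conv_lhs => rw [← v.sum_repr' u, map_sum]
    simp only [map_smul, hv, smul_smul]
  rw [h, v.orthonormal.inner_right_fintype]
  ring

lemma abs_le_lamBar [NeZero d] {i : Fin d} (hi : i ≠ 0) : |lam i| ≤ lamBar lam :=
  le_ciSup (f := fun i : {i : Fin d // i ≠ 0} => |lam i|) (Set.finite_range _).bddAbove ⟨i, hi⟩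

lemma lamBar_nonneg [NeZero d] : 0 ≤ lamBar lam := Real.iSup_nonneg fun _ => abs_nonneg _

lemma norm_apply_le_lamBar [NeZero d] (hv : ∀ i, A (v i) = lam i • v i) {u : E d} (hu : ⟪u, v 0⟫ = 0) :
    ‖A u‖ ≤ lamBar lam * ‖u‖ := by
  refine pow_le_pow_iff_left₀ (norm_nonneg _) (mul_nonneg lamBar_nonneg (norm_nonneg _))
    two_ne_zero |>.1 ?_
  rw [mul_pow, ← v.sum_sq_inner_right, ← v.sum_sq_inner_right u, Finset.mul_sum]
  refine Finset.sum_le_sum fun i _ => ?_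
  rw [inner_apply_of_eigenbasis hv, mul_pow]
  rcases eq_or_ne i 0 with rfl | hi
  · rw [real_inner_comm, hu]; simp
  · gcongr ?_ * _
    rw [← sq_abs]
    exact pow_le_pow_left₀ (abs_nonneg _) (abs_le_lamBar hi) 2

end Eigen

/-- Near the maximizer `v 0` the gradient of `g` is `ls u v_0 + ∇²g(v_0) y_⊥`, with `u` and `y_⊥`
the component of `y` along `v 0` and the orthogonal part, up to an error of size `M (1 - u)`. -/
lemma exists_gradient_eq [NeZero d] {g : E d → ℝ} {U D : Set (E d)} (hU : IsOpen U)
    (hg : ContDiffOn ℝ 3 g U) (hD : IsCompact D) (hDU : D ⊆ U) {ls : ℝ} {lam : Fin d → ℝ}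
    {v : OrthonormalBasis (Fin d) ℝ (E d)} (hls : gradient g (v 0) = ls • v 0)
    (hv : ∀ i, hessian g (v 0) (v i) = lam i • v i) {y : E d} (hy : ‖y‖ = 1)
    (hseg : segment ℝ y (v 0) ⊆ D) :
    ∃ r : E d, ‖r‖ ≤ constM g ls lam v D * (1 - ⟪y, v 0⟫) ∧
      gradient g y = (ls * ⟪y, v 0⟫) • v 0 + hessian g (v 0) (tl (v 0) y) + r := by
  set h := y - v 0 with hh
  have hn : ‖h‖ ^ 2 = 2 * (1 - ⟪y, v 0⟫) := norm_sub_sq_of_unit hy (v.orthonormal.1 0)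
  have hmem : ∀ t ∈ Set.Icc (0 : ℝ) 1, v 0 + t • h ∈ D := fun t ht => hseg (by
    rw [segment_symm, segment_eq_image']
    exact ⟨t, ht, rfl⟩)
  have key := norm_gradient_taylor_le hU hg (a := v 0) (h := h) (w := v 0)
    (c := (ls - lam 0) * ‖h‖ ^ 2) (fun t ht => hDU (hmem t ht))
    (fun t ht => norm_quadVec_add_le hU hg hD hDU ls lam v (hmem t ht) h)
  refine ⟨_, key.trans ?_, ?_⟩
  · have h1 : constM1 g ls lam v D ≤ constM g ls lam v D := le_max_left _ _
    have h2 : 0 ≤ 1 - ⟪y, v 0⟫ := by nlinarith [sq_nonneg ‖h‖]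
    rw [hn]
    nlinarith
  · have e1 : h = tl (v 0) y + (⟪y, v 0⟫ - 1) • v 0 := by rw [hh, tl]; module
    have e2 : hessian g (v 0) h
        = hessian g (v 0) (tl (v 0) y) + ((⟪y, v 0⟫ - 1) * lam 0) • v 0 := by
      rw [e1, map_add, map_smul, hv, smul_smul]
    have e3 : v 0 + h = y := by rw [hh]; abel
    rw [e2, e3, hls, hn]
    module

/-- Displacement of the noise-free direction: `∇f(y) - ls y` vanishes at the maximizer `v 0`. -/
lemma norm_gradient_sub_smul_le [NeZero d] {g : E d → ℝ} {U D : Set (E d)} (hU : IsOpen U)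
    (hg : ContDiffOn ℝ 3 g U) (hD : IsCompact D) (hDU : D ⊆ U) {ls : ℝ} (hls0 : 0 ≤ ls)
    {lam : Fin d → ℝ} {v : OrthonormalBasis (Fin d) ℝ (E d)} (hls : gradient g (v 0) = ls • v 0)
    {y : E d} (hy : ‖y‖ = 1) (hseg : segment ℝ y (v 0) ⊆ D) {Δ : ℝ} (hΔ : 1 - ⟪y, v 0⟫ ≤ Δ) :
    ‖gradient g y - ls • y‖
      ≤ (ls + ‖hessian g (v 0)‖ + constM g ls lam v D * √(Δ / 2)) * √(2 * Δ) := by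
  set h := y - v 0 with hh
  have hn : ‖h‖ ^ 2 = 2 * (1 - ⟪y, v 0⟫) := norm_sub_sq_of_unit hy (v.orthonormal.1 0)
  have hmem : ∀ t ∈ Set.Icc (0 : ℝ) 1, v 0 + t • h ∈ D := fun t ht => hseg (by
    rw [segment_symm, segment_eq_image']
    exact ⟨t, ht, rfl⟩)
  have key := norm_gradient_taylor_le hU hg (a := v 0) (h := h) (w := 0)
    (c := 0) (fun t ht => hDU (hmem t ht))
    (fun t ht => by
      rw [smul_zero, add_zero]
      exact norm_quadVec_le hU hg hD hDU (hmem t ht) h)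
  have e3 : v 0 + h = y := by rw [hh]; abel
  rw [smul_zero, add_zero, e3, hls] at key
  have hM0 : 0 ≤ constM g ls lam v D := (constM2_nonneg g D).trans (le_max_right _ _)
  have hM : constM2 g D ≤ constM g ls lam v D := le_max_right _ _
  have h1 : ‖h‖ ≤ √(2 * Δ) := Real.le_sqrt_of_sq_le (by linarith)
  have h2 : ‖h‖ / 2 ≤ √(Δ / 2) := Real.le_sqrt_of_sq_le (by linarith)
  have e : gradient g y - ls • y
      = (gradient g y - ls • v 0 - hessian g (v 0) h) + (hessian g (v 0) h - ls • h) := by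
    rw [hh]; module
  have hnn : 0 ≤ ‖h‖ := norm_nonneg h
  calc ‖gradient g y - ls • y‖
      ≤ constM2 g D * ‖h‖ ^ 2 / 2 + (‖hessian g (v 0)‖ * ‖h‖ + ls * ‖h‖) := by
        rw [e]
        refine (norm_add_le _ _).trans (add_le_add key ((norm_sub_le _ _).trans ?_))
        refine add_le_add (ContinuousLinearMap.le_opNorm _ _) ?_
        rw [norm_smul, Real.norm_eq_abs, abs_of_nonneg hls0]
    _ ≤ constM g ls lam v D * (√(Δ / 2) * ‖h‖) + (‖hessian g (v 0)‖ * ‖h‖ + ls * ‖h‖) := by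
        have : constM2 g D * ‖h‖ ^ 2 / 2 = constM2 g D * (‖h‖ / 2 * ‖h‖) := by ring
        rw [this]
        gcongr
    _ = (ls + ‖hessian g (v 0)‖ + constM g ls lam v D * √(Δ / 2)) * ‖h‖ := by ring
    _ ≤ _ := by gcongr

/-- The deviation of the variance-reduced mini-batch gradient at `y` from its mean, with the
reference point `w`. -/
noncomputable def noise (f : Fin n → E d → ℝ) (y w : E d) (S : Finset (Fin n)) : E d :=
  gradient (dev f S) y - gradient (dev f S) w

lemma norm_noise_le {f : Fin n → E d → ℝ} {U D : Set (E d)} (hU : IsOpen U)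
    (hf : ∀ i, ContDiffOn ℝ 2 (f i) U) (hD : IsCompact D) (hDU : D ⊆ U) {s : ℕ}
    {S : Finset (Fin n)} (hS : S ∈ batches n s) {y w : E d} (hseg : segment ℝ y w ⊆ D) :
    ‖noise f y w S‖ ≤ √(constL f s D) * ‖y - w‖ := by
  refine norm_gradient_sub_le hU (contDiffOn_dev hf S) hDU hseg fun z hz => ?_
  rw [norm_hessian_dev hU hf S (hDU hz)]
  exact Real.le_sqrt_of_sq_le (normG_sq_le_constL hU hf hD hDU hS fun _ => hz)

lemma batches_card_pos {s : ℕ} (hsn : s ≤ n) : 0 < (batches n s).card := by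
  rw [batches, Finset.card_powersetCard, Finset.card_univ, Fintype.card_fin]
  exact Nat.choose_pos hsn

lemma finset_sum_norm_gradient_sub_sq_le {ι : Type*} (B : Finset ι) {g : ι → E d → ℝ}
    {U D : Set (E d)} (hU : IsOpen U) (hg : ∀ i, ContDiffOn ℝ 2 (g i) U) {C : ℝ} {w y : E d}
    (hDU : D ⊆ U) (hseg : segment ℝ y w ⊆ D) (hC : ∀ z ∈ D, ∑ i ∈ B, ‖hessian (g i) z‖ ^ 2 ≤ C) :
    ∑ i ∈ B, ‖gradient (g i) y - gradient (g i) w‖ ^ 2 ≤ C * ‖y - w‖ ^ 2 := by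
  rw [← Finset.sum_coe_sort]
  exact sum_norm_gradient_sub_sq_le (g := fun i : B => g i) hU (fun i => hg i.1) hDU hseg
    fun z hz => (Finset.sum_coe_sort B fun i => ‖hessian (g i) z‖ ^ 2).trans_le (hC z hz)

lemma sum_norm_noise_sq_le {f : Fin n → E d → ℝ} {U D : Set (E d)} (hU : IsOpen U)
    (hf : ∀ i, ContDiffOn ℝ 2 (f i) U) (hD : IsCompact D) (hDU : D ⊆ U) {s : ℕ} (hsn : s ≤ n)
    {y w : E d} (hseg : segment ℝ y w ⊆ D) :
    ∑ S ∈ batches n s, ‖noise f y w S‖ ^ 2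
      ≤ (batches n s).card * (constK f s D * ‖y - w‖ ^ 2) := by
  have hc : (0 : ℝ) < (batches n s).card := by exact_mod_cast batches_card_pos hsn
  rw [← mul_assoc]
  refine finset_sum_norm_gradient_sub_sq_le _ hU (fun S => contDiffOn_dev hf S) hDU hseg
    fun z hz => ?_
  have := sum_normG_sq_le_constK (s := s) hU hf hD hDU (y := fun _ => z) fun _ => hz
  rw [div_le_iff₀ hc] at this
  simp only [norm_hessian_dev hU hf _ (hDU hz)]
  linarith

/-- Averaging the mini-batch means over all mini-batches gives the full mean. -/
lemma sum_batches_smul_sum {s : ℕ} (hs : 1 ≤ s) (hsn : s ≤ n) (z : Fin n → E d) :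
    ∑ S ∈ batches n s, (S.card : ℝ)⁻¹ • ∑ l ∈ S, z l
      = ((batches n s).card : ℝ) • (n : ℝ)⁻¹ • ∑ l, z l := by
  have h1 : ∀ S ∈ batches n s, (S.card : ℝ)⁻¹ • ∑ l ∈ S, z l
      = (s : ℝ)⁻¹ • ∑ l, if l ∈ S then z l else 0 := by
    intro S hS
    rw [(Finset.mem_powersetCard.1 hS).2, Finset.sum_ite_mem, Finset.univ_inter]
  have h2 : ∀ l, ∑ S ∈ batches n s, (if l ∈ S then z l else 0)
      = ((n - 1).choose (s - 1) : ℝ) • z l := by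
    intro l
    rw [← Finset.sum_filter, Finset.sum_const, ← Nat.cast_smul_eq_nsmul ℝ]
    congr 2
    have := Finset.card_filter_powersetCard_subset {l} (Finset.univ : Finset (Fin n)) s
      (Finset.subset_univ _) (by simpa using hs)
    simpa [batches] using this
  have hc : ((batches n s).card : ℝ) * (n : ℝ)⁻¹ = (s : ℝ)⁻¹ * ((n - 1).choose (s - 1) : ℝ) := by
    have hn0 : (n : ℝ) ≠ 0 := by norm_cast; omega
    have hs0 : (s : ℝ) ≠ 0 := by norm_cast; omega
    have h3 := Nat.add_one_mul_choose_eq (n - 1) (s - 1)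
    rw [Nat.sub_add_cancel (hs.trans hsn), Nat.sub_add_cancel hs] at h3
    have h4 : (batches n s).card = n.choose s := by simp [batches]
    rw [h4]
    field_simp
    exact_mod_cast h3.symm
  rw [Finset.sum_congr rfl h1, ← Finset.smul_sum, Finset.sum_comm, Finset.sum_congr rfl fun l _ =>
    h2 l, ← Finset.smul_sum, smul_smul, smul_smul, hc]

lemma sum_noise {f : Fin n → E d → ℝ} {y w : E d} (hy : ∀ i, DifferentiableAt ℝ (f i) y)
    (hw : ∀ i, DifferentiableAt ℝ (f i) w) {s : ℕ} (hs : 1 ≤ s) (hsn : s ≤ n) :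
    ∑ S ∈ batches n s, noise f y w S = 0 := by
  have h : ∀ z, (∀ i, DifferentiableAt ℝ (f i) z) →
      ∑ S ∈ batches n s, gradient (dev f S) z = 0 := by
    intro z hz
    simp only [gradient_dev hz, gradient_batch hz, gradient_avg hz, Finset.sum_sub_distrib]
    rw [sum_batches_smul_sum hs hsn, Finset.sum_const, ← Nat.cast_smul_eq_nsmul ℝ, sub_self]
  simp only [noise, Finset.sum_sub_distrib, h y hy, h w hw, sub_zero]

/-- Scaling form of one inner iteration: in terms of the directions `y` of the current iterate and
`y0` of the outer iterate, the variance-reduced gradient is `∇f(y)` plus the noise with reference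
point `⟨y, y0⟩ y0`. -/
lemma stepIter_eq {f : Fin n → E d → ℝ} {p : ℝ} (hf : ScaleInvariantFamily p f) {U : Set (E d)}
    (hU : IsOpen U) (hf2 : ∀ i, ContDiffOn ℝ 2 (f i) U) (η : ℝ) {x0 x y0 y : E d}
    (hx0 : x0 ≠ 0) (hx : x ≠ 0) (hy0 : x0 = ‖x0‖ • y0) (hy : x = ‖x‖ • y)
    (hpos : 0 ≤ ⟪y, y0⟫) (hyU : y ∈ U) (hwU : ⟪y, y0⟫ • y0 ∈ U)
    (S : Finset (Fin n)) :
    stepIter f p η x0 S x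
      = ‖x‖ • ((1 - η) • y + η • (gradient (avg f) y + noise f y (⟪y, y0⟫ • y0) S)) := by
  have hx0p : 0 < ‖x0‖ := norm_pos_iff.2 hx0
  have hxp : 0 < ‖x‖ := norm_pos_iff.2 hx
  have hy0n : y0 ≠ 0 := fun h => hx0 (by rw [hy0, h, smul_zero])
  have hyn : y ≠ 0 := fun h => hx (by rw [hy, h, smul_zero])
  set c := ⟪y, y0⟫ with hc
  set w := c • y0 with hw
  have hdiff : ∀ z ∈ U, ∀ i, DifferentiableAt ℝ (f i) z := fun z hz i =>
    ((hf2 i).differentiableOn (by norm_num)).differentiableAt (hU.mem_nhds hz)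
  set α : ℝ := |⟪x, x0⟫| ^ (p - 1) / ‖x0‖ ^ (2 * (p - 1)) with hα
  have hα' : α * ‖x0‖ ^ (p - 1) = ‖x‖ ^ (p - 1) * c ^ (p - 1) := by
    have h1 : |⟪x, x0⟫| = ‖x‖ * ‖x0‖ * c := by
      conv_lhs => rw [hy, hy0]
      rw [inner_smul_left, inner_smul_right, ← hc, conj_trivial, ← mul_assoc]
      exact abs_of_nonneg (by positivity)
    have h2 : ‖x0‖ ^ (2 * (p - 1)) = ‖x0‖ ^ (p - 1) * ‖x0‖ ^ (p - 1) := by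
      rw [two_mul, Real.rpow_add hx0p]
    have h3 : ‖x0‖ ^ (p - 1) ≠ 0 := (Real.rpow_pos_of_pos hx0p _).ne'
    rw [hα, h1, h2, Real.mul_rpow (by positivity) hpos, Real.mul_rpow hxp.le hx0p.le]
    field_simp
  -- the reference gradient, also when `c = 0`
  have href : ∀ g : E d → ℝ, (∀ c : ℝ, c ≠ 0 → ∀ x : E d, x ≠ 0 →
      gradient g (c • x) = (|c| ^ p / c) • gradient g x) → ContDiffOn ℝ 2 g U →
      α • gradient g x0 = ‖x‖ ^ (p - 1) • gradient g w := by
    intro g hg hgU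
    have h1 : gradient g x0 = ‖x0‖ ^ (p - 1) • gradient g y0 := by
      conv_lhs => rw [hy0]
      exact gradient_smul_of_pos hg hx0p hy0n
    have h2 : c ^ (p - 1) • gradient g y0 = gradient g w := by
      rcases hpos.eq_or_lt with h0 | h0
      · rw [hw, ← h0, zero_smul]
        rw [hw, ← h0, zero_smul] at hwU
        exact rpow_smul_gradient_zero hg
          (hasFDerivAt_gradient hU hgU hwU).continuousAt hy0n
      · exact (gradient_smul_of_pos hg h0 hy0n).symm
    rw [h1, smul_smul, hα', mul_smul, h2]
  have hcur : ∀ l, gradient (f l) x = ‖x‖ ^ (p - 1) • gradient (f l) y := by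
    intro l
    conv_lhs => rw [hy]
    exact gradient_smul_of_pos (fun c hc x hx => hf.gradient_smul l hc hx) hxp hyn
  have hg : α • gradient (avg f) x0
      + (S.card : ℝ)⁻¹ • ∑ l ∈ S, (gradient (f l) x - α • gradient (f l) x0)
      = ‖x‖ ^ (p - 1) • (gradient (avg f) y + noise f y w S) := by
    rw [href _ (fun c hc x hx => hf.gradient_avg_smul hc hx) (contDiffOn_avg hf2)]
    simp only [fun l => href (f l) (fun c hc x hx => hf.gradient_smul l hc hx) (hf2 l), hcur]
    rw [noise, gradient_dev (hdiff y hyU), gradient_dev (hdiff w hwU),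
      gradient_batch (hdiff y hyU), gradient_batch (hdiff w hwU), Finset.sum_sub_distrib,
      ← Finset.smul_sum, ← Finset.smul_sum]
    module
  have hpow : η / ‖x‖ ^ (p - 2) * ‖x‖ ^ (p - 1) = η * ‖x‖ := by
    have h1 : ‖x‖ ^ (p - 1) = ‖x‖ ^ (p - 2) * ‖x‖ := by
      rw [← Real.rpow_add_one hxp.ne']; ring_nf
    have h2 : ‖x‖ ^ (p - 2) ≠ 0 := (Real.rpow_pos_of_pos hxp _).ne'
    rw [h1]
    field_simp
  have hx' : stepIter f p η x0 S x = (1 - η) • x + (η / ‖x‖ ^ (p - 2)) •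
      (α • gradient (avg f) x0
        + (S.card : ℝ)⁻¹ • ∑ l ∈ S, (gradient (f l) x - α • gradient (f l) x0)) := rfl
  rw [hx', hg, smul_smul, hpow]
  conv_lhs => rw [hy]
  have hny : ‖‖x‖ • y‖ = ‖x‖ := by rw [← hy]
  rw [hny]
  module

/-! ### One step on average -/

/-- What the analysis of the iteration uses about the objective on the cap around `xs`: the
gradient of `f` is that of a quadratic form with matrix `ls xs xsᵀ + H`, where `‖H‖ ≤ lb` on the
orthogonal complement of `xs`, up to a quadratic error controlled by `M`, and the mini-batch noise
has mean zero and is controlled by `L` in the worst case and by `K` in the mean square. -/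
structure CapModel (f : Fin n → E d → ℝ) (p : ℝ) (s : ℕ) (xs : E d) (H : E d →L[ℝ] E d)
    (ls lb σ M K L Δ : ℝ) : Prop where
  unit : ‖xs‖ = 1
  lb_nonneg : 0 ≤ lb
  lb_lt : lb < ls
  M_nonneg : 0 ≤ M
  σ_nonneg : 0 ≤ σ
  Δ_nonneg : 0 ≤ Δ
  Δ_le : Δ ≤ 1 - 1 / √2
  K_nonneg : 0 ≤ K
  L_nonneg : 0 ≤ L
  card_pos : 0 < (batches n s).card
  norm_H_le : ∀ u, ⟪u, xs⟫ = 0 → ‖H u‖ ≤ lb * ‖u‖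
  inner_H : ∀ u, ⟪u, xs⟫ = 0 → ⟪H u, xs⟫ = 0
  gradient_eq : ∀ y ∈ cap xs Δ, ∃ r : E d, ‖r‖ ≤ M * (1 - ⟪y, xs⟫) ∧
    gradient (avg f) y = (ls * ⟪y, xs⟫) • xs + H (tl xs y) + r
  norm_gradient_sub_le : ∀ y ∈ cap xs Δ,
    ‖gradient (avg f) y - ls • y‖ ≤ (ls + σ + M * √(Δ / 2)) * √(2 * Δ)
  step : ∀ (η : ℝ) (x0 x y0 y : E d), x0 ≠ 0 → x ≠ 0 → x0 = ‖x0‖ • y0 → x = ‖x‖ • y →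
    y0 ∈ cap xs Δ → y ∈ cap xs Δ → ∀ S, stepIter f p η x0 S x
      = ‖x‖ • ((1 - η) • y + η • (gradient (avg f) y + noise f y (⟪y, y0⟫ • y0) S))
  noise_le : ∀ y0 ∈ cap xs Δ, ∀ y ∈ cap xs Δ, ∀ S ∈ batches n s,
    ‖noise f y (⟪y, y0⟫ • y0) S‖ ≤ √L * ‖tl y0 y‖
  sum_noise : ∀ y0 ∈ cap xs Δ, ∀ y ∈ cap xs Δ,
    ∑ S ∈ batches n s, noise f y (⟪y, y0⟫ • y0) S = 0
  sum_noise_sq : ∀ y0 ∈ cap xs Δ, ∀ y ∈ cap xs Δ,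
    ∑ S ∈ batches n s, ‖noise f y (⟪y, y0⟫ • y0) S‖ ^ 2
      ≤ (batches n s).card * (K * ‖tl y0 y‖ ^ 2)

/-- The cone of nonzero vectors whose direction lies in the cap. -/
def cone (xs : E d) (Δ : ℝ) : Set (E d) := {x | 0 < ‖x‖ ∧ (1 - Δ) * ‖x‖ ≤ ⟪x, xs⟫}

/-- The direction of a vector. -/
noncomputable def dir (x : E d) : E d := ‖x‖⁻¹ • x

lemma norm_smul_dir {x : E d} (hx : 0 < ‖x‖) : x = ‖x‖ • dir x := by
  rw [dir, smul_smul, mul_inv_cancel₀ hx.ne', one_smul]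

lemma dir_mem_cap {xs x : E d} {Δ : ℝ} (hx : x ∈ cone xs Δ) : dir x ∈ cap xs Δ := by
  refine ⟨?_, ?_⟩
  · rw [dir, norm_smul, norm_inv, norm_norm, inv_mul_cancel₀ hx.1.ne']
  · rw [dir, inner_smul_left, conj_trivial, ← div_eq_inv_mul]
    have := (le_div_iff₀ hx.1).2 hx.2
    linarith

lemma one_div_sqrt_two_sq : (1 / √2 : ℝ) ^ 2 = 1 / 2 := by
  rw [div_pow, Real.sq_sqrt (by norm_num)]; norm_num

lemma delta_lt {Δ : ℝ} (h : Δ ≤ 1 - 1 / √2) : Δ ≤ 3 / 10 := by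
  have h1 : (7 / 10 : ℝ) ≤ 1 / √2 :=
    pow_le_pow_iff_left₀ (by norm_num) (by positivity) two_ne_zero |>.1
      (by rw [one_div_sqrt_two_sq]; norm_num)
  linarith

lemma inner_eq_add_inner_tl {e : E d} (he : ‖e‖ = 1) (x y : E d) :
    ⟪x, y⟫ = ⟪x, e⟫ * ⟪y, e⟫ + ⟪tl e x, tl e y⟫ := by
  simp only [tl, inner_sub_left, inner_sub_right, inner_smul_left, inner_smul_right,
    real_inner_self_eq_norm_sq, he, conj_trivial]
  rw [real_inner_comm e y]
  ring

/-- Two directions within `45°` of `xs` form a nonobtuse angle. -/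
lemma inner_nonneg_of_mem_cap {xs y y0 : E d} {Δ : ℝ} (hxs : ‖xs‖ = 1) (hΔ : Δ ≤ 1 - 1 / √2)
    (hy : y ∈ cap xs Δ) (hy0 : y0 ∈ cap xs Δ) : 0 ≤ ⟪y, y0⟫ := by
  have key : ∀ z ∈ cap xs Δ, 1 / √2 ≤ ⟪z, xs⟫ ∧ ‖tl xs z‖ ≤ 1 / √2 := by
    intro z hz
    have h1 : 1 / √2 ≤ ⟪z, xs⟫ := by linarith [hz.2]
    have h2 := norm_sq_eq_inner_sq_add hxs z
    rw [hz.1] at h2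
    have h3 : (1 / √2 : ℝ) ^ 2 ≤ ⟪z, xs⟫ ^ 2 := pow_le_pow_left₀ (by positivity) h1 2
    refine ⟨h1, pow_le_pow_iff_left₀ (norm_nonneg _) (by positivity) two_ne_zero |>.1 ?_⟩
    rw [one_div_sqrt_two_sq] at *
    linarith
  obtain ⟨a1, b1⟩ := key y hy
  obtain ⟨a2, b2⟩ := key y0 hy0
  rw [inner_eq_add_inner_tl hxs]
  have h1 := abs_le.1 (abs_real_inner_le_norm (tl xs y) (tl xs y0))
  have hp : (0 : ℝ) ≤ 1 / √2 := by positivity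
  have h2 : ‖tl xs y‖ * ‖tl xs y0‖ ≤ 1 / √2 * (1 / √2) :=
    mul_le_mul b1 b2 (norm_nonneg _) hp
  have h3 : 1 / √2 * (1 / √2) ≤ ⟪y, xs⟫ * ⟪y0, xs⟫ := mul_le_mul a1 a2 hp (hp.trans a1)
  linarith [h1.1]

lemma norm_tl_unit_le {e : E d} (he : ‖e‖ = 1) (x : E d) (c : ℝ) : ‖tl e x‖ ≤ ‖x - c • e‖ := by
  have h : tl e x = tl e (x - c • e) := by
    simp only [tl, inner_sub_left, inner_smul_left, real_inner_self_eq_norm_sq, he, conj_trivial]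
    module
  rw [h]
  exact norm_tl_le he _

/-- Bias-variance decomposition. -/
lemma sum_norm_add_sq_of_sum_eq_zero {ι F : Type*} [NormedAddCommGroup F] [InnerProductSpace ℝ F]
    (B : Finset ι) (a : F) (b : ι → F) (hb : ∑ i ∈ B, b i = 0) :
    ∑ i ∈ B, ‖a + b i‖ ^ 2 = B.card * ‖a‖ ^ 2 + ∑ i ∈ B, ‖b i‖ ^ 2 := by
  simp only [norm_add_sq_real, Finset.sum_add_distrib, Finset.sum_const, nsmul_eq_mul]
  rw [← Finset.mul_sum, ← inner_sum, hb, inner_zero_right]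
  ring

namespace CapModel

variable {f : Fin n → E d → ℝ} {p : ℝ} {s : ℕ} {xs : E d} {H : E d →L[ℝ] E d}
  {ls lb σ M K L Δ η : ℝ}

/-- On the cap `1 - u` is of second order in the angle, hence small relative to both `u` and the
norm of the tail. -/
lemma one_sub_le (h : CapModel f p s xs H ls lb σ M K L Δ) {y : E d} (hy : y ∈ cap xs Δ) :
    0 ≤ 1 - ⟪y, xs⟫ ∧ 1 - ⟪y, xs⟫ ≤ √Δ * ⟪y, xs⟫ ∧ 1 - ⟪y, xs⟫ ≤ √Δ * ‖tl xs y‖ := by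
  have h1 := abs_le.1 (abs_real_inner_le_norm y xs)
  rw [hy.1, h.unit, mul_one] at h1
  have h2 := norm_sq_eq_inner_sq_add h.unit y
  rw [hy.1] at h2
  have hΔ := delta_lt h.Δ_le
  have hy2 := hy.2
  have hs := Real.sq_sqrt h.Δ_nonneg
  have hs0 := Real.sqrt_nonneg Δ
  set u := ⟪y, xs⟫
  refine ⟨by linarith, ?_, ?_⟩
  · have : √Δ ≤ 6 / 10 := by
      rw [Real.sqrt_le_left (by norm_num)]; norm_num; linarith
    calc 1 - u ≤ √Δ * √Δ := by nlinarith
      _ ≤ √Δ * u := by gcongr; linarith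
  · refine pow_le_pow_iff_left₀ (by linarith) (by positivity) two_ne_zero |>.1 ?_
    rw [mul_pow, hs]
    have : ‖tl xs y‖ ^ 2 = (1 - u) * (1 + u) := by nlinarith
    rw [this]
    nlinarith

/-- The noise-free step `(1 - η) y + η ∇f(y)` contracts the orthogonal part and expands the part
along `xs`. -/
lemma mean_step (h : CapModel f p s xs H ls lb σ M K L Δ) (hη0 : 0 ≤ η) (hη1 : η ≤ 1)
    {y : E d} (hy : y ∈ cap xs Δ) :
    let z := (1 - η) • y + η • gradient (avg f) y
    (1 - η + η * (ls - M * √Δ)) * ⟪y, xs⟫ ≤ ⟪z, xs⟫ ∧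
    ⟪z, xs⟫ ≤ (1 - η + η * (ls + M * √Δ)) * ⟪y, xs⟫ ∧
    ‖tl xs z‖ ≤ (1 - η + η * (lb + M * √Δ)) * ‖tl xs y‖ := by
  intro z
  obtain ⟨r, hr, hg⟩ := h.gradient_eq y hy
  obtain ⟨hu0, hu1, hu2⟩ := h.one_sub_le hy
  have hM := h.M_nonneg
  have ht := inner_tl h.unit y
  have hz : ⟪z, xs⟫ = (1 - η + η * ls) * ⟪y, xs⟫ + η * ⟪r, xs⟫ := by
    simp only [z, hg, inner_add_left, inner_smul_left, h.inner_H _ ht, real_inner_self_eq_norm_sq,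
      h.unit, conj_trivial]
    ring
  have hzt : tl xs z = (1 - η) • tl xs y + η • (H (tl xs y) + tl xs r) := by
    have e1 : tl xs ((ls * ⟪y, xs⟫) • xs) = 0 := by
      rw [tl_smul, tl, real_inner_self_eq_norm_sq, h.unit]; simp
    have e2 : tl xs (H (tl xs y)) = H (tl xs y) := by
      rw [tl, h.inner_H _ ht]; simp
    simp only [z, hg, tl_add, tl_smul, e2]
    rw [tl_smul] at e1
    rw [e1, zero_add]
  have hrx : |⟪r, xs⟫| ≤ ‖r‖ := by
    have := abs_real_inner_le_norm r xs
    rwa [h.unit, mul_one] at this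
  have hr1 : ‖r‖ ≤ M * √Δ * ⟪y, xs⟫ := hr.trans (by
    rw [mul_assoc]; exact mul_le_mul_of_nonneg_left hu1 hM)
  have hr2 : ‖r‖ ≤ M * √Δ * ‖tl xs y‖ := hr.trans (by
    rw [mul_assoc]; exact mul_le_mul_of_nonneg_left hu2 hM)
  have hab := abs_le.1 (hrx.trans hr1)
  refine ⟨?_, ?_, ?_⟩
  · rw [hz]; nlinarith [mul_le_mul_of_nonneg_left hab.1 hη0]
  · rw [hz]; nlinarith [mul_le_mul_of_nonneg_left hab.2 hη0]
  · rw [hzt]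
    have e1 : ‖(1 - η) • tl xs y‖ = (1 - η) * ‖tl xs y‖ := by
      rw [norm_smul, Real.norm_eq_abs, abs_of_nonneg (by linarith)]
    have e2 : ‖η • (H (tl xs y) + tl xs r)‖ ≤ η * (lb * ‖tl xs y‖ + M * √Δ * ‖tl xs y‖) := by
      rw [norm_smul, Real.norm_eq_abs, abs_of_nonneg hη0]
      refine mul_le_mul_of_nonneg_left ((norm_add_le _ _).trans (add_le_add ?_ ?_)) hη0
      · exact h.norm_H_le _ ht
      · exact (norm_tl_le h.unit r).trans hr2
    calc _ ≤ (1 - η) * ‖tl xs y‖ + η * (lb * ‖tl xs y‖ + M * √Δ * ‖tl xs y‖) :=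
          (norm_add_le _ _).trans (add_le_add e1.le e2)
      _ = _ := by ring

lemma step_eq (h : CapModel f p s xs H ls lb σ M K L Δ) (η : ℝ) {x0 x : E d}
    (hx0 : x0 ∈ cone xs Δ) (hx : x ∈ cone xs Δ) (S : Finset (Fin n)) :
    stepIter f p η x0 S x = ‖x‖ • (((1 - η) • dir x + η • gradient (avg f) (dir x))
      + η • noise f (dir x) (⟪dir x, dir x0⟫ • dir x0) S) := by
  rw [h.step η x0 x (dir x0) (dir x) (norm_pos_iff.1 hx0.1) (norm_pos_iff.1 hx.1)
    (norm_smul_dir hx0.1) (norm_smul_dir hx.1) (dir_mem_cap hx0) (dir_mem_cap hx) S]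
  module

/-- The squared distance of an iterate to the line of the outer iterate, which governs the noise,
in terms of the squared tangents of the two angles to `xs`. -/
lemma dist_line_sq_le (h : CapModel f p s xs H ls lb σ M K L Δ) {x0 x : E d}
    (hx0 : x0 ∈ cone xs Δ) (hx : x ∈ cone xs Δ) :
    ‖x‖ ^ 2 * ‖tl (dir x0) (dir x)‖ ^ 2
      ≤ 2 * ‖tl xs x‖ ^ 2 + 2 * (‖tl xs x0‖ ^ 2 / ⟪x0, xs⟫ ^ 2 * ⟪x, xs⟫ ^ 2) := by
  have hu : 0 < ⟪x0, xs⟫ := lt_of_lt_of_le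
    (mul_pos (by linarith [delta_lt h.Δ_le]) hx0.1) hx0.2
  set c := ⟪x, xs⟫ / ⟪x0, xs⟫ with hc
  have h1 : ‖x‖ * ‖tl (dir x0) (dir x)‖ ≤ ‖tl xs x - c • tl xs x0‖ := by
    have e1 : ‖x‖ * ‖tl (dir x0) (dir x)‖ = ‖tl (dir x0) x‖ := by
      conv_rhs => rw [norm_smul_dir hx.1, tl_smul, norm_smul, norm_norm]
    have e2 : tl xs x - c • tl xs x0 = x - (c * ‖x0‖) • dir x0 := by
      have : (c * ‖x0‖) • dir x0 = c • x0 := by rw [mul_smul, ← norm_smul_dir hx0.1]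
      rw [this, tl, tl, smul_sub, smul_smul, hc, div_mul_cancel₀ _ hu.ne']
      abel
    rw [e1, e2]
    exact norm_tl_unit_le (dir_mem_cap hx0).1 _ _
  have h2 : ‖tl xs x - c • tl xs x0‖ ^ 2 ≤ 2 * ‖tl xs x‖ ^ 2 + 2 * ‖c • tl xs x0‖ ^ 2 := by
    have := norm_sub_le (tl xs x) (c • tl xs x0)
    have e := pow_le_pow_left₀ (norm_nonneg _) this 2
    nlinarith [sq_nonneg (‖tl xs x‖ - ‖c • tl xs x0‖)]
  have h3 : ‖c • tl xs x0‖ ^ 2 = ‖tl xs x0‖ ^ 2 / ⟪x0, xs⟫ ^ 2 * ⟪x, xs⟫ ^ 2 := by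
    rw [norm_smul, mul_pow, Real.norm_eq_abs, sq_abs, hc, div_pow]
    ring
  rw [← mul_pow]
  refine (pow_le_pow_left₀ (by positivity) h1 2).trans (h2.trans ?_)
  rw [h3]

/-- One step, averaged over the mini-batches. -/
lemma average_step (h : CapModel f p s xs H ls lb σ M K L Δ) (hη0 : 0 ≤ η) (hη1 : η ≤ 1)
    (ham : 0 ≤ 1 - η + η * (ls - M * √Δ)) {x0 x : E d} (hx0 : x0 ∈ cone xs Δ)
    (hx : x ∈ cone xs Δ) :
    let N := 2 * ‖tl xs x‖ ^ 2 + 2 * (‖tl xs x0‖ ^ 2 / ⟪x0, xs⟫ ^ 2 * ⟪x, xs⟫ ^ 2)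
    (1 - η + η * (ls - M * √Δ)) ^ 2 * ⟪x, xs⟫ ^ 2
      ≤ (∑ S ∈ batches n s, ⟪stepIter f p η x0 S x, xs⟫ ^ 2) / (batches n s).card ∧
    (∑ S ∈ batches n s, ⟪stepIter f p η x0 S x, xs⟫ ^ 2) / (batches n s).card
      ≤ (1 - η + η * (ls + M * √Δ)) ^ 2 * ⟪x, xs⟫ ^ 2 + η ^ 2 * K * N ∧
    (∑ S ∈ batches n s, ‖tl xs (stepIter f p η x0 S x)‖ ^ 2) / (batches n s).card
      ≤ (1 - η + η * (lb + M * √Δ)) ^ 2 * ‖tl xs x‖ ^ 2 + η ^ 2 * K * N := by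
  intro N
  set y := dir x with hy
  set y0 := dir x0 with hy0
  have hyc : y ∈ cap xs Δ := dir_mem_cap hx
  have hy0c : y0 ∈ cap xs Δ := dir_mem_cap hx0
  set e : Finset (Fin n) → E d := noise f y (⟪y, y0⟫ • y0) with he
  have hsum : ∑ S ∈ batches n s, e S = 0 := h.sum_noise y0 hy0c y hyc
  have hsq := h.sum_noise_sq y0 hy0c y hyc
  obtain ⟨hz1, hz2, hz3⟩ := h.mean_step hη0 hη1 hyc
  set z := (1 - η) • y + η • gradient (avg f) y with hz
  have hc : (0 : ℝ) < (batches n s).card := by exact_mod_cast h.card_pos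
  have hN : ‖x‖ ^ 2 * ‖tl y0 y‖ ^ 2 ≤ N := h.dist_line_sq_le hx0 hx
  have hstep : ∀ S, stepIter f p η x0 S x = ‖x‖ • (z + η • e S) := h.step_eq η hx0 hx
  have hux : ⟪x, xs⟫ = ‖x‖ * ⟪y, xs⟫ := by
    conv_lhs => rw [norm_smul_dir hx.1]
    rw [inner_smul_left, conj_trivial]
  have hwx : ‖tl xs x‖ = ‖x‖ * ‖tl xs y‖ := by
    conv_lhs => rw [norm_smul_dir hx.1, tl_smul, norm_smul, norm_norm]
  have hu0 : 0 ≤ ⟪y, xs⟫ := by linarith [hyc.2, delta_lt h.Δ_le]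
  have hhead : ∑ S ∈ batches n s, ⟪stepIter f p η x0 S x, xs⟫ ^ 2
      = ‖x‖ ^ 2 * ((batches n s).card * ⟪z, xs⟫ ^ 2
        + ∑ S ∈ batches n s, (η * ⟪e S, xs⟫) ^ 2) := by
    have e1 := sum_norm_add_sq_of_sum_eq_zero (batches n s) ⟪z, xs⟫ (fun S => η * ⟪e S, xs⟫)
      (by rw [← Finset.mul_sum, ← sum_inner, hsum, inner_zero_left, mul_zero])
    simp only [Real.norm_eq_abs, sq_abs] at e1
    rw [← e1, Finset.mul_sum]
    refine Finset.sum_congr rfl fun S _ => ?_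
    rw [hstep, inner_smul_left, inner_add_left, inner_smul_left, conj_trivial, conj_trivial]
    ring
  have htail : ∑ S ∈ batches n s, ‖tl xs (stepIter f p η x0 S x)‖ ^ 2
      = ‖x‖ ^ 2 * ((batches n s).card * ‖tl xs z‖ ^ 2
        + ∑ S ∈ batches n s, ‖η • tl xs (e S)‖ ^ 2) := by
    rw [← sum_norm_add_sq_of_sum_eq_zero (batches n s) (tl xs z) (fun S => η • tl xs (e S)),
      Finset.mul_sum]
    · refine Finset.sum_congr rfl fun S _ => ?_
      rw [hstep, tl_smul, tl_add, tl_smul, norm_smul, norm_norm, mul_pow]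
    · rw [← Finset.smul_sum]
      have : ∑ S ∈ batches n s, tl xs (e S) = tl xs (∑ S ∈ batches n s, e S) := by
        simp only [tl, Finset.sum_sub_distrib, sum_inner, Finset.sum_smul]
      rw [this, hsum, tl]
      simp
  have hbound : ∀ φ : Finset (Fin n) → ℝ, (∀ S ∈ batches n s, φ S ≤ η ^ 2 * ‖e S‖ ^ 2) →
      ‖x‖ ^ 2 * ∑ S ∈ batches n s, φ S ≤ (batches n s).card * (η ^ 2 * K * N) := by
    intro φ hφ
    have e1 : ∑ S ∈ batches n s, φ S
        ≤ η ^ 2 * ((batches n s).card * (K * ‖tl y0 y‖ ^ 2)) := by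
      refine (Finset.sum_le_sum hφ).trans ?_
      rw [← Finset.mul_sum]
      exact mul_le_mul_of_nonneg_left hsq (sq_nonneg _)
    calc ‖x‖ ^ 2 * ∑ S ∈ batches n s, φ S
        ≤ ‖x‖ ^ 2 * (η ^ 2 * ((batches n s).card * (K * ‖tl y0 y‖ ^ 2))) := by gcongr
      _ = (batches n s).card * (η ^ 2 * K * (‖x‖ ^ 2 * ‖tl y0 y‖ ^ 2)) := by ring
      _ ≤ _ := by
        have := h.K_nonneg
        gcongr
  have hb1 := hbound (fun S => (η * ⟪e S, xs⟫) ^ 2) fun S _ => by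
    rw [mul_pow, ← sq_abs ⟪e S, xs⟫]
    have := abs_real_inner_le_norm (e S) xs
    rw [h.unit, mul_one] at this
    gcongr
  have hb2 := hbound (fun S => ‖η • tl xs (e S)‖ ^ 2) fun S _ => by
    rw [norm_smul, mul_pow, Real.norm_eq_abs, sq_abs]
    have := norm_tl_le h.unit (e S)
    gcongr
  have hz0 : 0 ≤ (1 - η + η * (ls - M * √Δ)) * ⟪y, xs⟫ := mul_nonneg ham hu0
  have q1 := pow_le_pow_left₀ hz0 hz1 2
  have q2 := pow_le_pow_left₀ (hz0.trans hz1) hz2 2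
  have q3 := pow_le_pow_left₀ (norm_nonneg _) hz3 2
  have hpos : 0 ≤ ∑ S ∈ batches n s, (η * ⟪e S, xs⟫) ^ 2 :=
    Finset.sum_nonneg fun S _ => sq_nonneg _
  rw [hhead, htail, hux, hwx]
  refine ⟨?_, ?_, ?_⟩
  · rw [le_div_iff₀ hc]
    calc _ = ‖x‖ ^ 2 * ((batches n s).card * ((1 - η + η * (ls - M * √Δ)) * ⟪y, xs⟫) ^ 2) := by
          ring
      _ ≤ ‖x‖ ^ 2 * ((batches n s).card * ⟪z, xs⟫ ^ 2 + 0) := by rw [add_zero]; gcongr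
      _ ≤ _ := by gcongr
  · rw [div_le_iff₀ hc, mul_add]
    calc _ ≤ ‖x‖ ^ 2 * ((batches n s).card * ((1 - η + η * (ls + M * √Δ)) * ⟪y, xs⟫) ^ 2)
          + (batches n s).card * (η ^ 2 * K * N) := by gcongr
      _ = _ := by ring
  · rw [div_le_iff₀ hc, mul_add]
    calc _ ≤ ‖x‖ ^ 2 * ((batches n s).card * ((1 - η + η * (lb + M * √Δ)) * ‖tl xs y‖) ^ 2)
          + (batches n s).card * (η ^ 2 * K * N) := by gcongr
      _ = _ := by ring

end CapModel

/-! ### Invariance of the cone -/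

lemma norm_tl_comm {y z : E d} (hy : ‖y‖ = 1) (hz : ‖z‖ = 1) : ‖tl y z‖ = ‖tl z y‖ := by
  have h1 := norm_sq_eq_inner_sq_add hy z
  have h2 := norm_sq_eq_inner_sq_add hz y
  rw [real_inner_comm] at h2
  rw [hy] at h2
  rw [hz] at h1
  exact (pow_left_inj₀ (norm_nonneg _) (norm_nonneg _) two_ne_zero).1 (by linarith)

lemma mul_add_mul_sq_le {a b c t : ℝ} (ht : t ^ 2 = 1 - c ^ 2) :
    (a * c + b * t) ^ 2 ≤ b ^ 2 + a ^ 2 := by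
  have h : b ^ 2 + a ^ 2 - (a * c + b * t) ^ 2 = (a * t - b * c) ^ 2 := by
    have : t ^ 2 + c ^ 2 = 1 := by linarith
    linear_combination (-(a ^ 2 + b ^ 2)) * this
  nlinarith [sq_nonneg (a * t - b * c)]

/-- The planar part of the invariance of the cone: the cone has half-angle with cosine `C` and sine
`Sn`, the current direction has coordinates `(u, w)`, and the error has coordinates `(v, t)`. The
first conclusion excludes the opposite cone. -/
lemma cone_step_real {η ls lb C Sn u w v t b : ℝ} (hη0 : 0 < η) (hη1 : η ≤ 1) (hlb : 0 ≤ lb)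
    (hgap : lb < ls) (hC0 : 0 < C) (huC : C ≤ u) (hSn0 : 0 ≤ Sn) (hSn2 : Sn ^ 2 = 1 - C ^ 2)
    (hw0 : 0 ≤ w) (huw : 1 = u ^ 2 + w ^ 2) (hv : |v| ≤ (ls - lb) * (C * Sn))
    (htv : t * C + |v| * Sn ≤ (ls - lb) * (C * Sn))
    (hb : b ≤ (1 - η + η * lb) * w + η * t) :
    0 < (1 - η + η * ls) * u + η * v ∧ b * C ≤ ((1 - η + η * ls) * u + η * v) * Sn := by
  have hu0 : 0 < u := hC0.trans_le huC
  have hSn1 : Sn < 1 := by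
    have := pow_pos hC0 2
    exact lt_of_pow_lt_pow_left₀ 2 zero_le_one (by linarith)
  have hwu : w * C ≤ u * Sn := by
    refine pow_le_pow_iff_left₀ (by positivity) (by positivity) two_ne_zero |>.1 ?_
    rw [mul_pow, mul_pow, hSn2]
    have : C ^ 2 ≤ u ^ 2 := pow_le_pow_left₀ hC0.le huC 2
    have : w ^ 2 = 1 - u ^ 2 := by linarith
    rw [this]
    linarith
  have e1 : (ls - lb) * (C * Sn) ≤ (ls - lb) * (u * Sn) :=
    mul_le_mul_of_nonneg_left (mul_le_mul_of_nonneg_right huC hSn0) (by linarith)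
  have hvl : -|v| ≤ v := neg_abs_le v
  constructor
  · have e2 : (ls - lb) * (u * Sn) < ls * u := by
      calc (ls - lb) * (u * Sn) = ((ls - lb) * u) * Sn := by ring
        _ < ((ls - lb) * u) * 1 := mul_lt_mul_of_pos_left hSn1 (mul_pos (by linarith) hu0)
        _ ≤ ls * u := by rw [mul_one]; exact mul_le_mul_of_nonneg_right (by linarith) hu0.le
    have e3 : 0 < η * (ls * u + v) := mul_pos hη0 (by linarith)
    have e4 : 0 ≤ (1 - η) * u := mul_nonneg (by linarith) hu0.le
    linarith
  · have e2 : b * C ≤ ((1 - η + η * lb) * w + η * t) * C := mul_le_mul_of_nonneg_right hb hC0.le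
    have e3 : (1 - η + η * lb) * (w * C) ≤ (1 - η + η * lb) * (u * Sn) :=
      mul_le_mul_of_nonneg_left hwu (by have := mul_nonneg hη0.le hlb; linarith)
    have e4 : η * (t * C + |v| * Sn) ≤ η * ((ls - lb) * (u * Sn)) :=
      mul_le_mul_of_nonneg_left (htv.trans e1) hη0.le
    have e5 : η * (-|v| * Sn) ≤ η * (v * Sn) :=
      mul_le_mul_of_nonneg_left (mul_le_mul_of_nonneg_right hvl hSn0) hη0.le
    linarith

namespace CapModel

variable {f : Fin n → E d → ℝ} {p : ℝ} {s : ℕ} {xs : E d} {H : E d →L[ℝ] E d}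
  {ls lb σ M K L Δ η : ℝ}

lemma norm_tl_le_of_mem_cap (h : CapModel f p s xs H ls lb σ M K L Δ) {y y0 : E d}
    (hy : y ∈ cap xs Δ) (hy0 : y0 ∈ cap xs Δ) : ‖tl y0 y‖ ≤ 2 * √(2 * Δ) := by
  have key : ∀ z ∈ cap xs Δ, ‖z - xs‖ ≤ √(2 * Δ) := fun z hz =>
    Real.le_sqrt_of_sq_le (by rw [norm_sub_sq_of_unit hz.1 h.unit]; linarith [hz.2])
  have h1 := norm_tl_unit_le hy0.1 y 1
  have h2 : y - (1 : ℝ) • y0 = (y - xs) - (y0 - xs) := by rw [one_smul]; abel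
  rw [h2] at h1
  have h3 := norm_sub_le (y - xs) (y0 - xs)
  linarith [key y hy, key y0 hy0]

/-- One step stays in the cone if, on its boundary, the spectral gap beats the Taylor error `M Δ`
plus the noise. -/
lemma step_mem_cone (h : CapModel f p s xs H ls lb σ M K L Δ) (hη0 : 0 < η) (hη1 : η ≤ 1)
    {x0 x : E d} (hx0 : x0 ∈ cone xs Δ) (hx : x ∈ cone xs Δ) {S : Finset (Fin n)}
    (hS : S ∈ batches n s)
    (hcond : √L * ‖tl (dir x0) (dir x)‖ + M * Δ
      ≤ (ls - lb) * ((1 - Δ) * √(1 - (1 - Δ) ^ 2))) :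
    stepIter f p η x0 S x ∈ cone xs Δ := by
  rw [h.step_eq η hx0 hx]
  set y := dir x with hy
  set y0 := dir x0 with hy0
  have hyc : y ∈ cap xs Δ := dir_mem_cap hx
  have hy0c : y0 ∈ cap xs Δ := dir_mem_cap hx0
  have he := h.noise_le y0 hy0c y hyc S hS
  set e := noise f y (⟪y, y0⟫ • y0) S
  obtain ⟨r, hr, hg⟩ := h.gradient_eq y hyc
  obtain ⟨hu0, -, -⟩ := h.one_sub_le hyc
  have ht := inner_tl h.unit y
  set C := 1 - Δ with hC
  set Sn := √(1 - C ^ 2) with hSn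
  have hΔ3 := delta_lt h.Δ_le
  have hΔ0 := h.Δ_nonneg
  have hSn0 : 0 ≤ Sn := Real.sqrt_nonneg _
  have hSn2 : Sn ^ 2 = 1 - C ^ 2 := Real.sq_sqrt (by nlinarith)
  have hC0 : 0 < C := by linarith
  set u := ⟪y, xs⟫ with hu
  have huC : C ≤ u := by linarith [hyc.2]
  set w := ‖tl xs y‖ with hw
  have huw : 1 = u ^ 2 + w ^ 2 := by
    have := norm_sq_eq_inner_sq_add h.unit y
    rw [hyc.1] at this; linarith
  have hw0 : 0 ≤ w := norm_nonneg _
  have hgap := h.lb_lt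
  have hlb := h.lb_nonneg
  set V := r + e with hV
  have hVn : ‖V‖ ≤ (ls - lb) * (C * Sn) := by
    refine (norm_add_le _ _).trans (le_trans ?_ hcond)
    have : M * (1 - u) ≤ M * Δ := mul_le_mul_of_nonneg_left (by linarith) h.M_nonneg
    linarith
  set q := ((1 - η) • y + η • gradient (avg f) y) + η • e with hq
  have hqa : ⟪q, xs⟫ = (1 - η + η * ls) * u + η * ⟪V, xs⟫ := by
    simp only [hq, hg, hV, inner_add_left, inner_smul_left, h.inner_H _ ht,
      real_inner_self_eq_norm_sq, h.unit, conj_trivial]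
    ring
  have hqt : tl xs q = (1 - η) • tl xs y + η • (H (tl xs y) + tl xs V) := by
    have e1 : tl xs ((ls * u) • xs) = 0 := by
      rw [tl_smul, tl, real_inner_self_eq_norm_sq, h.unit]; simp
    have e2 : tl xs (H (tl xs y)) = H (tl xs y) := by
      rw [tl, h.inner_H _ ht]; simp
    simp only [hq, hg, hV, tl_add, e1, zero_add, e2, tl_smul]
    module
  have hqb : ‖tl xs q‖ ≤ (1 - η + η * lb) * w + η * ‖tl xs V‖ := by
    rw [hqt]
    refine (norm_add_le _ _).trans ?_
    rw [norm_smul, norm_smul, Real.norm_eq_abs, Real.norm_eq_abs, abs_of_pos hη0,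
      abs_of_nonneg (by linarith : 0 ≤ 1 - η)]
    have := mul_le_mul_of_nonneg_left
      ((norm_add_le (H (tl xs y)) (tl xs V)).trans (add_le_add_left (h.norm_H_le _ ht) _)) hη0.le
    linarith
  have hVx : |⟪V, xs⟫| ≤ ‖V‖ := by
    have := abs_real_inner_le_norm V xs
    rwa [h.unit, mul_one] at this
  have hCS : ‖tl xs V‖ * C + |⟪V, xs⟫| * Sn ≤ ‖V‖ := by
    refine abs_le_of_sq_le_sq' ?_ (norm_nonneg _) |>.2
    rw [norm_sq_eq_inner_sq_add h.unit V, ← sq_abs ⟪V, xs⟫]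
    exact mul_add_mul_sq_le hSn2
  obtain ⟨ha, hb⟩ := cone_step_real hη0 hη1 hlb hgap hC0 huC hSn0 hSn2 hw0 huw
    (hVx.trans hVn) (hCS.trans hVn) hqb
  rw [← hqa] at ha hb
  have hqn : C * ‖q‖ ≤ ⟪q, xs⟫ := by
    refine abs_le_of_sq_le_sq' ?_ ha.le |>.2
    have e1 := pow_le_pow_left₀ (by positivity) hb 2
    rw [mul_pow, mul_pow, hSn2] at e1
    rw [mul_pow, norm_sq_eq_inner_sq_add h.unit q]
    linarith
  have hq0 : 0 < ‖q‖ := by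
    refine norm_pos_iff.2 fun h0 => ?_
    rw [h0, inner_zero_left] at ha
    exact lt_irrefl _ ha
  refine ⟨?_, ?_⟩
  · rw [norm_smul, norm_norm]; exact mul_pos hx.1 hq0
  · rw [norm_smul, norm_norm, inner_smul_left, conj_trivial]
    nlinarith [mul_le_mul_of_nonneg_left hqn hx.1.le]

/-- One step is a multiple of the current iterate up to a small displacement. -/
lemma norm_step_sub_le (h : CapModel f p s xs H ls lb σ M K L Δ) (hη0 : 0 ≤ η)
    {x0 x : E d} (hx0 : x0 ∈ cone xs Δ) (hx : x ∈ cone xs Δ) {S : Finset (Fin n)}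
    (hS : S ∈ batches n s) :
    ‖stepIter f p η x0 S x - (1 - η + η * ls) • x‖
      ≤ η * (theta1 ls σ M L Δ * √(2 * Δ)) * ‖x‖ := by
  rw [h.step_eq η hx0 hx]
  set y := dir x with hy
  set y0 := dir x0 with hy0
  have hyc : y ∈ cap xs Δ := dir_mem_cap hx
  have hy0c : y0 ∈ cap xs Δ := dir_mem_cap hx0
  have he := h.noise_le y0 hy0c y hyc S hS
  set e := noise f y (⟪y, y0⟫ • y0) S
  have e1 : ‖x‖ • (((1 - η) • y + η • gradient (avg f) y) + η • e) - (1 - η + η * ls) • x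
      = (‖x‖ * η) • ((gradient (avg f) y - ls • y) + e) := by
    conv_lhs => rw [norm_smul_dir hx.1, ← hy]
    have : ‖‖x‖ • y‖ = ‖x‖ := by rw [hy, ← norm_smul_dir hx.1]
    rw [this]
    module
  rw [e1, norm_smul, Real.norm_eq_abs, abs_of_nonneg (by positivity)]
  have e2 : ‖(gradient (avg f) y - ls • y) + e‖ ≤ theta1 ls σ M L Δ * √(2 * Δ) := by
    refine (norm_add_le _ _).trans ?_
    have q1 := h.norm_gradient_sub_le y hyc
    have q2 : √L * ‖tl y0 y‖ ≤ √L * (2 * √(2 * Δ)) :=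
      mul_le_mul_of_nonneg_left (h.norm_tl_le_of_mem_cap hyc hy0c) (Real.sqrt_nonneg _)
    rw [theta1]
    linarith
  calc ‖x‖ * η * ‖(gradient (avg f) y - ls • y) + e‖
      ≤ ‖x‖ * η * (theta1 ls σ M L Δ * √(2 * Δ)) := by gcongr
    _ = _ := by ring

/-- The product of cosine and sine of the half-angle of the cone is at least `√Δ / 2`. -/
lemma half_sqrt_le (h : CapModel f p s xs H ls lb σ M K L Δ) :
    √Δ / 2 ≤ (1 - Δ) * √(1 - (1 - Δ) ^ 2) := by
  have hΔ := delta_lt h.Δ_le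
  have hΔ0 := h.Δ_nonneg
  refine abs_le_of_sq_le_sq' ?_ (mul_nonneg (by linarith) (Real.sqrt_nonneg _)) |>.2
  rw [mul_pow, Real.sq_sqrt (by nlinarith), div_pow, Real.sq_sqrt hΔ0]
  have e : (1 - Δ) ^ 2 * (1 - (1 - Δ) ^ 2) = Δ * ((1 - Δ) ^ 2 * (2 - Δ)) := by ring
  rw [e]
  have e1 : (49 / 100 : ℝ) ≤ (1 - Δ) ^ 2 := by nlinarith
  have e2 : (1 / 4 : ℝ) ≤ (1 - Δ) ^ 2 * (2 - Δ) := by nlinarith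
  nlinarith

lemma cone_condition_of_noise_le (h : CapModel f p s xs H ls lb σ M K L Δ) {a : ℝ}
    (ha : a ≤ (ls - lb - 2 * M * √Δ) * √Δ / 2) :
    a + M * Δ ≤ (ls - lb) * ((1 - Δ) * √(1 - (1 - Δ) ^ 2)) := by
  have h1 := mul_le_mul_of_nonneg_left h.half_sqrt_le (sub_nonneg.2 h.lb_lt.le)
  have h2 : M * (√Δ * √Δ) = M * Δ := by rw [Real.mul_self_sqrt h.Δ_nonneg]
  linarith

/-- All the iterates of an epoch stay in the cone, for every choice of the mini-batches. If `L` is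
small the noise is harmless anywhere in the cone; otherwise the step size is so small that the
iterates of one epoch stay close to the direction of the outer iterate, where the noise vanishes. -/
lemma innerIter_mem_cone (h : CapModel f p s xs H ls lb σ M K L Δ) (hη0 : 0 < η) (hη1 : η ≤ 1)
    (hγ : 0 < ls - lb - 2 * M * √Δ) {m : ℕ}
    (hcase : L ≤ (ls - lb - 2 * M * √Δ) ^ 2 / 32 ∨
      (8 * L * (m * η * theta1 ls σ M L Δ) ^ 2
          ≤ ((ls - lb - 2 * M * √Δ) * (1 - η + η * ls) / 2) ^ 2 ∧
        2 * m * (η * (theta1 ls σ M L Δ * √(2 * Δ))) ≤ 1 - η + η * ls))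
    {x0 : E d} (hx0 : x0 ∈ cone xs Δ) {S : ℕ → Finset (Fin n)}
    (hS : ∀ t < m, S t ∈ batches n s) :
    ∀ t ≤ m, innerIter f p η x0 S t ∈ cone xs Δ := by
  set γ := ls - lb - 2 * M * √Δ with hγdef
  have hsΔ : √Δ ^ 2 = Δ := Real.sq_sqrt h.Δ_nonneg
  have hsΔ0 := Real.sqrt_nonneg Δ
  have hs2Δ : √(2 * Δ) ^ 2 = 2 * Δ := Real.sq_sqrt (by linarith [h.Δ_nonneg])
  have hL2 : √L ^ 2 = L := Real.sq_sqrt h.L_nonneg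
  rcases hcase with hL | ⟨hc1, hc2⟩
  · intro t
    induction t with
    | zero => exact fun _ => hx0
    | succ t ih =>
      intro ht
      have hx := ih (by omega)
      refine h.step_mem_cone hη0 hη1 hx0 hx (hS t (by omega)) (h.cone_condition_of_noise_le ?_)
      have h1 := h.norm_tl_le_of_mem_cap (dir_mem_cap hx) (dir_mem_cap hx0)
      have h2 := mul_le_mul_of_nonneg_left h1 (Real.sqrt_nonneg L)
      refine h2.trans (abs_le_of_sq_le_sq' ?_ (by positivity) |>.2)
      rw [mul_pow, mul_pow, hL2, hs2Δ, div_pow, mul_pow, hsΔ]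
      nlinarith [h.Δ_nonneg]
  · set α := 1 - η + η * ls with hα
    set ε := η * (theta1 ls σ M L Δ * √(2 * Δ)) with hε
    have hls : 0 < ls := h.lb_nonneg.trans_lt h.lb_lt
    have hα0 : 0 < α := by have := mul_pos hη0 hls; linarith
    have hθ0 : 0 ≤ theta1 ls σ M L Δ := by
      have := h.M_nonneg
      have := h.σ_nonneg
      unfold theta1
      positivity
    have hε0 : 0 ≤ ε := by positivity
    have hx0p := hx0.1
    -- with `z_t = x_t / α ^ t`, each step moves `z_t` by at most `ε / α` times its norm
    suffices H : ∀ t ≤ m, innerIter f p η x0 S t ∈ cone xs Δ ∧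
        ‖innerIter f p η x0 S t - α ^ t • x0‖ * α ≤ 2 * t * ε * (α ^ t * ‖x0‖) from
      fun t ht => (H t ht).1
    intro t
    induction t with
    | zero => intro _; exact ⟨hx0, by simp [innerIter]⟩
    | succ t ih =>
      intro ht
      obtain ⟨hx, hdist⟩ := ih (by omega)
      set x := innerIter f p η x0 S t with hxdef
      have hstep : innerIter f p η x0 S (t + 1) = stepIter f p η x0 (S t) x := rfl
      have htm : (t : ℝ) ≤ m := by exact_mod_cast (by omega : t ≤ m)
      have hP : 0 < α ^ t * ‖x0‖ := by positivity
      have hdist' : ‖x - α ^ t • x0‖ * α ≤ 2 * m * ε * (α ^ t * ‖x0‖) :=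
        hdist.trans (by gcongr)
      have hdist1 : ‖x - α ^ t • x0‖ ≤ α ^ t * ‖x0‖ := by
        have : 2 * m * ε * (α ^ t * ‖x0‖) ≤ α * (α ^ t * ‖x0‖) := by gcongr
        nlinarith
      rw [hstep]
      refine ⟨h.step_mem_cone hη0 hη1 hx0 hx (hS t (by omega))
        (h.cone_condition_of_noise_le ?_), ?_⟩
      · have hy := dir_mem_cap hx
        have hy0 := dir_mem_cap hx0
        have h1 : ‖tl (dir x0) (dir x)‖ * α ≤ 2 * m * ε := by
          rw [norm_tl_comm hy0.1 hy.1]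
          have e1 := norm_tl_unit_le hy.1 (dir x0) (‖x‖ / (α ^ t * ‖x0‖))
          have e2 : dir x0 - (‖x‖ / (α ^ t * ‖x0‖)) • dir x
              = (α ^ t * ‖x0‖)⁻¹ • (α ^ t • x0 - x) := by
            rw [smul_sub, div_eq_inv_mul, mul_smul _ ‖x‖, ← norm_smul_dir hx.1, smul_smul, dir]
            congr 2
            field_simp
          rw [e2, norm_smul, norm_sub_rev, norm_inv, Real.norm_eq_abs, abs_of_pos hP,
            ← div_eq_inv_mul, le_div_iff₀ hP] at e1
          have e3 : ‖tl (dir x) (dir x0)‖ * α * (α ^ t * ‖x0‖) ≤ 2 * m * ε * (α ^ t * ‖x0‖) := by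
            nlinarith
          exact le_of_mul_le_mul_right e3 hP
        have h2 : (√L * ‖tl (dir x0) (dir x)‖) * α ≤ γ * √Δ / 2 * α := by
          have e1 : √L * (‖tl (dir x0) (dir x)‖ * α) ≤ √L * (2 * m * ε) :=
            mul_le_mul_of_nonneg_left h1 (Real.sqrt_nonneg _)
          have e2 : √L * (2 * m * ε) ≤ γ * √Δ / 2 * α := by
            refine abs_le_of_sq_le_sq' ?_ (by positivity) |>.2
            have q1 : (√L * (2 * m * ε)) ^ 2
                = (8 * L * (m * η * theta1 ls σ M L Δ) ^ 2) * Δ := by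
              rw [hε]
              calc _ = √L ^ 2 * (4 * (m * η * theta1 ls σ M L Δ) ^ 2) * √(2 * Δ) ^ 2 := by ring
                _ = _ := by rw [hL2, hs2Δ]; ring
            have q2 : (γ * √Δ / 2 * α) ^ 2 = (γ * α / 2) ^ 2 * Δ := by
              calc _ = (γ * α / 2) ^ 2 * √Δ ^ 2 := by ring
                _ = _ := by rw [hsΔ]
            rw [q1, q2]
            exact mul_le_mul_of_nonneg_right hc1 h.Δ_nonneg
          linarith
        exact le_of_mul_le_mul_right h2 hα0
      · have e1 := h.norm_step_sub_le hη0.le hx0 hx (hS t (by omega))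
        have e2 : stepIter f p η x0 (S t) x - α ^ (t + 1) • x0
            = (stepIter f p η x0 (S t) x - α • x) + α • (x - α ^ t • x0) := by
          rw [pow_succ]; module
        have e3 : ‖x‖ ≤ 2 * (α ^ t * ‖x0‖) := by
          have q1 := norm_add_le (x - α ^ t • x0) (α ^ t • x0)
          rw [sub_add_cancel, norm_smul (α ^ t), Real.norm_eq_abs,
            abs_of_pos (pow_pos hα0 t)] at q1
          linarith
        have e4 : ‖stepIter f p η x0 (S t) x - α ^ (t + 1) • x0‖
            ≤ ε * (2 * (α ^ t * ‖x0‖)) + α * ‖x - α ^ t • x0‖ := by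
          rw [e2]
          refine (norm_add_le _ _).trans (add_le_add (e1.trans ?_) ?_)
          · gcongr
          · rw [norm_smul, Real.norm_eq_abs, abs_of_pos hα0]
        calc _ ≤ (ε * (2 * (α ^ t * ‖x0‖)) + α * ‖x - α ^ t • x0‖) * α := by gcongr
          _ ≤ ε * (2 * (α ^ t * ‖x0‖)) * α + α * (2 * t * ε * (α ^ t * ‖x0‖)) := by
            have := mul_le_mul_of_nonneg_left hdist hα0.le
            linarith
          _ = _ := by push_cast; ring

end CapModel

/-! ### Averaging over the mini-batches -/

/-- `Z` is a function of the mini-batches with indices in `F`. -/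
def DependsOnBatches {Ω β : Type*} (S : ℕ → ℕ → Ω → Finset (Fin n)) (F : Finset (ℕ × ℕ))
    (Z : Ω → β) : Prop :=
  ∃ ψ : (F → Finset (Fin n)) → β, ∀ ω, Z ω = ψ fun q => S q.1.1 q.1.2 ω

lemma DependsOnBatches.comp {Ω β γ : Type*} {S : ℕ → ℕ → Ω → Finset (Fin n)}
    {F : Finset (ℕ × ℕ)} {Z : Ω → β} (hZ : DependsOnBatches S F Z) (g : β → γ) :
    DependsOnBatches S F fun ω => g (Z ω) := by
  obtain ⟨ψ, hψ⟩ := hZ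
  exact ⟨fun a => g (ψ a), fun ω => congrArg g (hψ ω)⟩

lemma UniformBatches.measurableSet_eq {Ω : Type*} [MeasurableSpace Ω] {μ : Measure Ω} {s : ℕ}
    {S : ℕ → ℕ → Ω → Finset (Fin n)} (hS : UniformBatches μ s S) (T t : ℕ) (A : Finset (Fin n)) :
    MeasurableSet {ω | S T t ω = A} :=
  hS.measurable T t (MeasurableSpace.measurableSet_top (s := {A}))

section Prob

variable {Ω : Type*} [MeasurableSpace Ω] {μ : Measure Ω} [IsProbabilityMeasure μ] {s : ℕ}
  {S : ℕ → ℕ → Ω → Finset (Fin n)} {β : Type*} {F : Finset (ℕ × ℕ)} {Z : Ω → β}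

lemma UniformBatches.integrable (hS : UniformBatches μ s S) {Z : Ω → ℝ}
    (hZ : DependsOnBatches S F Z) : Integrable Z μ := by
  obtain ⟨ψ, hψ⟩ := hZ
  let _ : MeasurableSpace (Finset (Fin n)) := ⊤
  have : Z = ψ ∘ fun ω (q : F) => S q.1.1 q.1.2 ω := funext hψ
  rw [this]
  have hm : Measurable fun ω (q : F) => S q.1.1 q.1.2 ω :=
    measurable_pi_iff.2 fun q => hS.measurable _ _
  have := Measure.isProbabilityMeasure_map (μ := μ) hm.aemeasurable
  exact (Integrable.of_finite (μ := μ.map fun ω (q : F) => S q.1.1 q.1.2 ω)).comp_measurable hm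

lemma UniformBatches.ae_mem (hS : UniformBatches μ s S) (hsn : s ≤ n) :
    ∀ᵐ ω ∂μ, ∀ T t, S T t ω ∈ batches n s := by
  refine ae_all_iff.2 fun T => ae_all_iff.2 fun t => ?_
  have h1 : {ω | S T t ω ∈ batches n s} = ⋃ A ∈ batches n s, {ω | S T t ω = A} := by
    ext ω; simp
  have hm : MeasurableSet {ω | S T t ω ∈ batches n s} := by
    rw [h1]
    exact Finset.measurableSet_biUnion _ fun A _ => hS.measurableSet_eq T t A
  have h2 : μ.real {ω | S T t ω ∈ batches n s} = 1 := by
    rw [h1, measureReal_biUnion_finset]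
    · rw [Finset.sum_congr rfl fun A hA => hS.uniform T t A hA, Finset.sum_const, nsmul_eq_mul]
      have : ((batches n s).card : ℝ) ≠ 0 := by exact_mod_cast (batches_card_pos hsn).ne'
      field_simp
    · intro A _ A' _ hne
      exact Set.disjoint_left.2 fun ω h h' => hne (h.symm.trans h')
    · exact fun A _ => hS.measurableSet_eq T t A
  have h3 : μ {ω | S T t ω ∈ batches n s} = 1 := by
    rw [measureReal_def] at h2
    exact (ENNReal.toReal_eq_one_iff _).1 h2
  exact (prob_compl_eq_zero_iff hm).2 h3

/-- A mini-batch that is independent of `Z` may be averaged out. -/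
lemma UniformBatches.integral_step (hS : UniformBatches μ s S) (hsn : s ≤ n) {T t : ℕ}
    (hF : (T, t) ∉ F) (hZ : DependsOnBatches S F Z) (Φ : Finset (Fin n) → β → ℝ) :
    ∫ ω, Φ (S T t ω) (Z ω) ∂μ
      = ∫ ω, (∑ A ∈ batches n s, Φ A (Z ω)) / (batches n s).card ∂μ := by
  classical
  have hΦ : ∀ A, DependsOnBatches S F fun ω => Φ A (Z ω) := fun A => hZ.comp (Φ A)
  have hint : ∀ A, Integrable (fun ω => Φ A (Z ω)) μ := fun A => hS.integrable (hΦ A)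
  let I : Finset (Fin n) → Ω → ℝ := fun A => {ω | S T t ω = A}.indicator 1
  have hI : ∀ A, Integrable (I A) μ := fun A =>
    (integrable_const (1 : ℝ)).indicator (hS.measurableSet_eq T t A)
  have hind : ∀ A, IndepFun (I A) (fun ω => Φ A (Z ω)) μ := by
    intro A
    obtain ⟨ψ, hψ⟩ := hΦ A
    let _ : MeasurableSpace (Finset (Fin n)) := ⊤
    have h1 := hS.indep.indepFun_finset {(T, t)} F (Finset.disjoint_singleton_left.2 hF)
      fun q => hS.measurable q.1 q.2
    have h2 := h1.comp
      (φ := fun a : ({(T, t)} : Finset (ℕ × ℕ)) → Finset (Fin n) =>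
        if a ⟨(T, t), Finset.mem_singleton_self _⟩ = A then (1 : ℝ) else 0)
      (ψ := ψ) (measurable_of_finite _) (measurable_of_finite _)
    have e1 : I A = (fun a : ({(T, t)} : Finset (ℕ × ℕ)) → Finset (Fin n) =>
        if a ⟨(T, t), Finset.mem_singleton_self _⟩ = A then (1 : ℝ) else 0) ∘
          fun ω (q : ({(T, t)} : Finset (ℕ × ℕ))) => S q.1.1 q.1.2 ω := by
      ext ω
      simp [I, Set.indicator_apply]
    have e2 : (fun ω => Φ A (Z ω)) = ψ ∘ fun ω (q : F) => S q.1.1 q.1.2 ω := funext hψ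
    rw [e1, e2]
    exact h2
  have hmul : ∀ A, ∫ ω, I A ω * Φ A (Z ω) ∂μ = (∫ ω, I A ω ∂μ) * ∫ ω, Φ A (Z ω) ∂μ := fun A =>
    (hind A).integral_fun_mul_eq_mul_integral (hI A).aestronglyMeasurable
      (hint A).aestronglyMeasurable
  have hImul : ∀ A, Integrable (fun ω => I A ω * Φ A (Z ω)) μ := fun A =>
    (hind A).integrable_mul (hI A) (hint A)
  have h1 : ∫ ω, Φ (S T t ω) (Z ω) ∂μ
      = ∫ ω, ∑ A ∈ batches n s, I A ω * Φ A (Z ω) ∂μ := by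
    refine integral_congr_ae ?_
    filter_upwards [hS.ae_mem hsn] with ω hω
    rw [Finset.sum_eq_single_of_mem _ (hω T t)]
    · simp [I]
    · intro A _ hA
      simp [I, hA.symm]
  rw [h1, integral_finsetSum _ fun A _ => hImul A]
  have h2 : ∀ A ∈ batches n s, ∫ ω, I A ω * Φ A (Z ω) ∂μ
      = (∫ ω, Φ A (Z ω) ∂μ) / (batches n s).card := by
    intro A hA
    rw [hmul, integral_indicator_one (hS.measurableSet_eq T t A), hS.uniform T t A hA]
    ring
  rw [Finset.sum_congr rfl h2, ← Finset.sum_div, integral_div,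
    integral_finsetSum _ fun A _ => hint A]

end Prob

lemma innerIter_congr (f : Fin n → E d → ℝ) (p η : ℝ) (x0 : E d) {S S' : ℕ → Finset (Fin n)}
    (t : ℕ) (h : ∀ r < t, S r = S' r) : innerIter f p η x0 S t = innerIter f p η x0 S' t := by
  induction t with
  | zero => rfl
  | succ t ih =>
    rw [innerIter, innerIter, ih fun r hr => h r (by omega), h t (by omega)]

lemma outerIter_congr (f : Fin n → E d → ℝ) (p η : ℝ) (m : ℕ) (x0 : E d)
    {S S' : ℕ → ℕ → Finset (Fin n)} (T : ℕ) (h : ∀ r < T, ∀ t < m, S r t = S' r t) :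
    outerIter f p η m x0 S T = outerIter f p η m x0 S' T := by
  induction T with
  | zero => rfl
  | succ T ih =>
    rw [outerIter, outerIter, ih fun r hr => h r (by omega)]
    exact innerIter_congr f p η _ m fun t ht => h T (by omega) t ht

/-- The outer iterate and the inner iterates of epoch `T` before the draw `(T, t)` depend only on
mini-batches other than that draw. -/
lemma dependsOnBatches_iterates {Ω : Type*} (f : Fin n → E d → ℝ) (p η : ℝ) (m : ℕ) (x0 : E d)
    (S : ℕ → ℕ → Ω → Finset (Fin n)) (T t : ℕ) :
    DependsOnBatches S ((Finset.range (T + 1) ×ˢ Finset.range (m + t)).erase (T, t))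
      fun ω => (outerIter f p η m x0 (fun T' t' => S T' t' ω) T,
        innerIter f p η (outerIter f p η m x0 (fun T' t' => S T' t' ω) T)
          (fun t' => S T t' ω) t) := by
  classical
  set F := (Finset.range (T + 1) ×ˢ Finset.range (m + t)).erase (T, t) with hF
  let ext : (F → Finset (Fin n)) → ℕ → ℕ → Finset (Fin n) := fun a T' t' =>
    if h : (T', t') ∈ F then a ⟨(T', t'), h⟩ else ∅
  refine ⟨fun a => (outerIter f p η m x0 (ext a) T,
    innerIter f p η (outerIter f p η m x0 (ext a) T) (ext a T) t), fun ω => ?_⟩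
  have hext : ∀ T' t', (T', t') ∈ F →
      S T' t' ω = ext (fun q => S q.1.1 q.1.2 ω) T' t' := fun T' t' h => by simp [ext, h]
  have e1 : outerIter f p η m x0 (fun T' t' => S T' t' ω) T
      = outerIter f p η m x0 (ext fun q => S q.1.1 q.1.2 ω) T := by
    refine outerIter_congr f p η m x0 T fun r hr t' ht' => hext r t' ?_
    simp only [hF, Finset.mem_erase, Finset.mem_product, Finset.mem_range, ne_eq, Prod.mk.injEq]
    omega
  beta_reduce
  rw [e1]
  congr 1
  refine innerIter_congr f p η _ t fun r hr => hext T r ?_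
  simp only [hF, Finset.mem_erase, Finset.mem_product, Finset.mem_range, ne_eq, Prod.mk.injEq]
  omega

/-! ### One epoch in expectation -/

namespace CapModel

variable {f : Fin n → E d → ℝ} {p : ℝ} {s : ℕ} {xs : E d} {H : E d →L[ℝ] E d}
  {ls lb σ M K L Δ η : ℝ}

lemma head_pos (h : CapModel f p s xs H ls lb σ M K L Δ) {x : E d} (hx : x ∈ cone xs Δ) :
    0 < ⟪x, xs⟫ :=
  lt_of_lt_of_le (mul_pos (by linarith [delta_lt h.Δ_le]) hx.1) hx.2

/-- The squared tangent of the angle to `xs` is at most `1` on the cone. -/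
lemma tail_div_head_le_one (h : CapModel f p s xs H ls lb σ M K L Δ) {x : E d}
    (hx : x ∈ cone xs Δ) : ‖tl xs x‖ ^ 2 / ⟪x, xs⟫ ^ 2 ≤ 1 := by
  have h0 := h.head_pos hx
  rw [div_le_one (pow_pos h0 2)]
  have h1 : 1 / √2 * ‖x‖ ≤ ⟪x, xs⟫ :=
    le_trans (mul_le_mul_of_nonneg_right (by linarith [h.Δ_le]) (norm_nonneg _)) hx.2
  have h2 := pow_le_pow_left₀ (by positivity) h1 2
  rw [mul_pow, one_div_sqrt_two_sq, norm_sq_eq_inner_sq_add h.unit x] at h2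
  linarith

lemma outerIter_mem_cone {η : ℝ} {m : ℕ}
    (hcone : ∀ x0 ∈ cone xs Δ, ∀ S : ℕ → Finset (Fin n), (∀ t < m, S t ∈ batches n s) →
      ∀ t ≤ m, innerIter f p η x0 S t ∈ cone xs Δ)
    {x0 : E d} (hx0 : x0 ∈ cone xs Δ) {S : ℕ → ℕ → Finset (Fin n)}
    (hS : ∀ T t, S T t ∈ batches n s) (T : ℕ) : outerIter f p η m x0 S T ∈ cone xs Δ := by
  induction T with
  | zero => exact hx0
  | succ T ih => exact hcone _ ih _ (fun t _ => hS T t) m le_rfl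

/-- One epoch in expectation. The noise injected in the epoch is proportional to the squared
distance from the iterates to the line of the outer iterate `x̃_T`; hence besides `E ‖x_⊥‖²` the
recursion tracks the expectation of `(xᵀxs)²` weighted by the squared tangent of `x̃_T`. -/
lemma epoch_integral (h : CapModel f p s xs H ls lb σ M K L Δ) (hη0 : 0 < η) (hη1 : η ≤ 1)
    {m : ℕ} (hm : 1 ≤ m) (hγ : 0 < ls - lb - 2 * M * √Δ)
    (hcone : ∀ x0 ∈ cone xs Δ, ∀ S : ℕ → Finset (Fin n), (∀ t < m, S t ∈ batches n s) →
      ∀ t ≤ m, innerIter f p η x0 S t ∈ cone xs Δ)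
    (ham : 0 < 1 - η + η * (ls - M * √Δ))
    (hν4 : 64 * η * K ≤ (ls - lb - 2 * M * √Δ) * (1 - η + η * (ls + M * √Δ)))
    (hν5 : 2 * m * (η * (ls - lb - 2 * M * √Δ)) ≤ 1 - η + η * (ls - M * √Δ))
    (hν5' : 4 * m * (η * (M * √Δ)) ≤ Real.log 2 * (1 - η + η * (ls - M * √Δ)))
    {Ω : Type*} [MeasurableSpace Ω] {μ : Measure Ω} [IsProbabilityMeasure μ]
    {S : ℕ → ℕ → Ω → Finset (Fin n)} (hS : UniformBatches μ s S) (hsn : s ≤ n)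
    {x0 : E d} (hx0 : x0 ∈ cone xs Δ) {X : ℕ → Ω → E d}
    (hX : ∀ T ω, X T ω = outerIter f p η m x0 (fun T' t => S T' t ω) T) (T : ℕ) :
    (∫ ω, ‖tl xs (X (T + 1) ω)‖ ^ 2 ∂μ
      ≤ (1 - m * (η * (ls - lb - 2 * M * √Δ) / (1 - η + η * (ls - M * √Δ))) / 2)
        * (((1 - η + η * (ls - M * √Δ)) ^ 2) ^ m * ∫ ω, ‖tl xs (X T ω)‖ ^ 2 ∂μ)) ∧
    ((1 - η + η * (ls - M * √Δ)) ^ 2) ^ m * ∫ ω, ⟪X T ω, xs⟫ ^ 2 ∂μ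
      ≤ ∫ ω, ⟪X (T + 1) ω, xs⟫ ^ 2 ∂μ := by
  set am := 1 - η + η * (ls - M * √Δ) with hamdef
  set γ := ls - lb - 2 * M * √Δ with hγdef
  have hM := h.M_nonneg
  have hK := h.K_nonneg
  have hsΔ := Real.sqrt_nonneg Δ
  have hm1 : (1 : ℝ) ≤ m := by exact_mod_cast hm
  set q := η * γ / am with hq
  set pp := 2 * (η * (M * √Δ)) / am with hpp
  set k := η ^ 2 * K / am ^ 2 with hk
  have hq0 : 0 ≤ q := by positivity
  have hp0 : 0 ≤ pp := by positivity
  have hk0 : 0 ≤ k := by positivity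
  have hqa : q * am = η * γ := div_mul_cancel₀ _ ham.ne'
  have hpa : pp * am = 2 * (η * (M * √Δ)) := div_mul_cancel₀ _ ham.ne'
  have hka : k * am ^ 2 = η ^ 2 * K := div_mul_cancel₀ _ (by positivity)
  have hq1 : q * (2 * m) ≤ 1 := by
    refine le_of_mul_le_mul_right ?_ ham
    calc q * (2 * m) * am = 2 * m * (q * am) := by ring
      _ ≤ 1 * am := by rw [hqa]; linarith
  have hp1 : 2 * pp * m ≤ Real.log 2 := by
    refine le_of_mul_le_mul_right ?_ ham
    calc 2 * pp * m * am = 2 * m * (pp * am) := by ring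
      _ ≤ Real.log 2 * am := by rw [hpa]; linarith
  have hp2 : pp ≤ 3 / 5 := by
    have := Real.log_two_lt_d9
    nlinarith
  have hk1 : 40 * k ≤ q := by
    have e1 : 1 - η + η * (ls + M * √Δ) = am * (1 + pp) := by
      rw [hamdef] at hpa ⊢; linarith
    rw [e1] at hν4
    have e2 : 64 * (k * am ^ 2) ≤ q * (1 + pp) * am ^ 2 := by
      calc 64 * (k * am ^ 2) = η * (64 * η * K) := by rw [hka]; ring
        _ ≤ η * (γ * (am * (1 + pp))) := by gcongr
        _ = (η * γ) * (am * (1 + pp)) := by ring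
        _ = q * (1 + pp) * am ^ 2 := by rw [← hqa]; ring
    have e3 : 64 * k ≤ q * (1 + pp) :=
      le_of_mul_le_mul_right (by linarith) (pow_pos ham 2)
    nlinarith
  have hbe : 1 - η + η * (lb + M * √Δ) = am * (1 - q) := by
    have : am * (1 - q) = am - q * am := by ring
    rw [this, hqa, hamdef, hγdef]; ring
  have hap : 1 - η + η * (ls + M * √Δ) = am * (1 + pp) := by
    have : am * (1 + pp) = am + pp * am := by ring
    rw [this, hpa, hamdef]; ring
  -- the inner iterates of epoch `T`, and the squared tangent of the outer iterate
  set Y : ℕ → Ω → E d := fun t ω => innerIter f p η (X T ω) (fun t' => S T t' ω) t with hY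
  let τ : E d → ℝ := fun x => ‖tl xs x‖ ^ 2 / ⟪x, xs⟫ ^ 2
  have hdep : ∀ t, DependsOnBatches S
      ((Finset.range (T + 1) ×ˢ Finset.range (m + t)).erase (T, t))
      fun ω => (X T ω, Y t ω) := by
    intro t
    have := dependsOnBatches_iterates f p η m x0 S T t
    simpa only [hY, hX] using this
  have hnot : ∀ t, (T, t) ∉ (Finset.range (T + 1) ×ˢ Finset.range (m + t)).erase (T, t) :=
    fun t => Finset.notMem_erase _ _
  have hint : ∀ t (φ : E d × E d → ℝ), Integrable (fun ω => φ (X T ω, Y t ω)) μ := fun t φ =>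
    hS.integrable ((hdep t).comp φ)
  have hae : ∀ᵐ ω ∂μ, X T ω ∈ cone xs Δ ∧ ∀ t ≤ m, Y t ω ∈ cone xs Δ := by
    filter_upwards [hS.ae_mem hsn] with ω hω
    have h1 : X T ω ∈ cone xs Δ := by
      rw [hX]; exact outerIter_mem_cone hcone hx0 hω T
    exact ⟨h1, hcone _ h1 _ fun t _ => hω T t⟩
  have hstep : ∀ t (Φ : E d → E d → ℝ), ∫ ω, Φ (X T ω) (Y (t + 1) ω) ∂μ
      = ∫ ω, (∑ A ∈ batches n s, Φ (X T ω) (stepIter f p η (X T ω) A (Y t ω)))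
        / (batches n s).card ∂μ := fun t Φ =>
    hS.integral_step hsn (hnot t) (hdep t) fun A z => Φ z.1 (stepIter f p η z.1 A z.2)
  have hY0 : Y 0 = X T := rfl
  have hYm : Y m = X (T + 1) := by
    funext ω
    simp only [hY, hX]
    rfl
  set B : ℕ → ℝ := fun t => ∫ ω, ‖tl xs (Y t ω)‖ ^ 2 ∂μ with hB
  set W : ℕ → ℝ := fun t => ∫ ω, τ (X T ω) * ⟪Y t ω, xs⟫ ^ 2 ∂μ with hW
  set A : ℕ → ℝ := fun t => ∫ ω, ⟪Y t ω, xs⟫ ^ 2 ∂μ with hA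
  have iB : ∀ t, Integrable (fun ω => ‖tl xs (Y t ω)‖ ^ 2) μ := fun t =>
    hint t fun z => ‖tl xs z.2‖ ^ 2
  have iW : ∀ t, Integrable (fun ω => τ (X T ω) * ⟪Y t ω, xs⟫ ^ 2) μ := fun t =>
    hint t fun z => τ z.1 * ⟪z.2, xs⟫ ^ 2
  have iN : ∀ t, Integrable (fun ω => 2 * ‖tl xs (Y t ω)‖ ^ 2 +
      2 * (τ (X T ω) * ⟪Y t ω, xs⟫ ^ 2)) μ := fun t =>
    hint t fun z => 2 * ‖tl xs z.2‖ ^ 2 + 2 * (τ z.1 * ⟪z.2, xs⟫ ^ 2)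
  have hN : ∀ t, ∫ ω, 2 * ‖tl xs (Y t ω)‖ ^ 2 + 2 * (τ (X T ω) * ⟪Y t ω, xs⟫ ^ 2) ∂μ
      = 2 * B t + 2 * W t := fun t => by
    rw [integral_add ((iB t).const_mul 2) ((iW t).const_mul 2), integral_const_mul,
      integral_const_mul]
  have hB0 : 0 ≤ B 0 := integral_nonneg fun ω => by positivity
  have hW0 : W 0 = B 0 := by
    refine integral_congr_ae ?_
    filter_upwards [hae] with ω hω
    have := h.head_pos hω.1
    simp only [hY0, τ]
    field_simp
  have hBs : ∀ t < m, B (t + 1) ≤ am ^ 2 * ((1 - q) ^ 2 * B t + k * (2 * B t + 2 * W t)) := by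
    intro t ht
    have e := hstep t fun _ x => ‖tl xs x‖ ^ 2
    simp only [hB]
    rw [e]
    have hr : am ^ 2 * ((1 - q) ^ 2 * B t + k * (2 * B t + 2 * W t))
        = ∫ ω, (am * (1 - q)) ^ 2 * ‖tl xs (Y t ω)‖ ^ 2 + η ^ 2 * K *
          (2 * ‖tl xs (Y t ω)‖ ^ 2 + 2 * (τ (X T ω) * ⟪Y t ω, xs⟫ ^ 2)) ∂μ := by
      rw [integral_add ((iB t).const_mul _) ((iN t).const_mul _), integral_const_mul,
        integral_const_mul, hN, ← hka]
      ring
    change _ ≤ am ^ 2 * ((1 - q) ^ 2 * B t + k * (2 * B t + 2 * W t))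
    rw [hr]
    refine integral_mono_ae (hint t fun z => (∑ A ∈ batches n s,
      ‖tl xs (stepIter f p η z.1 A z.2)‖ ^ 2) / (batches n s).card)
      (hint t fun z => (am * (1 - q)) ^ 2 * ‖tl xs z.2‖ ^ 2 + η ^ 2 * K *
          (2 * ‖tl xs z.2‖ ^ 2 + 2 * (τ z.1 * ⟪z.2, xs⟫ ^ 2))) ?_
    filter_upwards [hae] with ω hω
    have := (h.average_step hη0.le hη1 ham.le hω.1 (hω.2 t ht.le)).2.2
    rw [hbe] at this
    exact this
  have hWs : ∀ t < m, W (t + 1) ≤ am ^ 2 * ((1 + pp) ^ 2 * W t + k * (2 * B t + 2 * W t)) := by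
    intro t ht
    have e := hstep t fun x x' => τ x * ⟪x', xs⟫ ^ 2
    simp only [hW]
    rw [e]
    have hr : am ^ 2 * ((1 + pp) ^ 2 * W t + k * (2 * B t + 2 * W t))
        = ∫ ω, (am * (1 + pp)) ^ 2 * (τ (X T ω) * ⟪Y t ω, xs⟫ ^ 2) + η ^ 2 * K *
          (2 * ‖tl xs (Y t ω)‖ ^ 2 + 2 * (τ (X T ω) * ⟪Y t ω, xs⟫ ^ 2)) ∂μ := by
      rw [integral_add ((iW t).const_mul _) ((iN t).const_mul _), integral_const_mul,
        integral_const_mul, hN, ← hka]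
      ring
    change _ ≤ am ^ 2 * ((1 + pp) ^ 2 * W t + k * (2 * B t + 2 * W t))
    rw [hr]
    refine integral_mono_ae (hint t fun z => (∑ A ∈ batches n s,
      τ z.1 * ⟪stepIter f p η z.1 A z.2, xs⟫ ^ 2) / (batches n s).card)
      (hint t fun z => (am * (1 + pp)) ^ 2 * (τ z.1 * ⟪z.2, xs⟫ ^ 2) + η ^ 2 * K *
          (2 * ‖tl xs z.2‖ ^ 2 + 2 * (τ z.1 * ⟪z.2, xs⟫ ^ 2))) ?_
    filter_upwards [hae] with ω hω
    have key := (h.average_step hη0.le hη1 ham.le hω.1 (hω.2 t ht.le)).2.1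
    rw [hap] at key
    have hτ1 : τ (X T ω) ≤ 1 := h.tail_div_head_le_one hω.1
    have hτ0 : 0 ≤ τ (X T ω) := by positivity
    rw [← Finset.mul_sum, mul_div_assoc]
    have hN : 0 ≤ η ^ 2 * K *
        (2 * ‖tl xs (Y t ω)‖ ^ 2 + 2 * (τ (X T ω) * ⟪Y t ω, xs⟫ ^ 2)) := by positivity
    calc _ ≤ τ (X T ω) * ((am * (1 + pp)) ^ 2 * ⟪Y t ω, xs⟫ ^ 2 + η ^ 2 * K *
          (2 * ‖tl xs (Y t ω)‖ ^ 2 + 2 * (τ (X T ω) * ⟪Y t ω, xs⟫ ^ 2))) :=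
          mul_le_mul_of_nonneg_left key hτ0
      _ ≤ _ := by
        have := mul_le_mul_of_nonneg_right hτ1 hN
        linarith
  have hAs : ∀ t < m, am ^ 2 * A t ≤ A (t + 1) := by
    intro t ht
    have e := hstep t fun _ x => ⟪x, xs⟫ ^ 2
    simp only [hA]
    rw [e, ← integral_const_mul]
    refine integral_mono_ae (hint t fun z => am ^ 2 * ⟪z.2, xs⟫ ^ 2)
      (hint t fun z => (∑ A ∈ batches n s,
        ⟪stepIter f p η z.1 A z.2, xs⟫ ^ 2) / (batches n s).card) ?_
    filter_upwards [hae] with ω hω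
    exact (h.average_step hη0.le hη1 ham.le hω.1 (hω.2 t ht.le)).1
  have hAm : ∀ t ≤ m, (am ^ 2) ^ t * A 0 ≤ A t := by
    intro t
    induction t with
    | zero => intro _; simp
    | succ t ih =>
      intro ht
      refine le_trans ?_ (hAs t (by omega))
      have := mul_le_mul_of_nonneg_left (ih (by omega)) (sq_nonneg am)
      calc _ = am ^ 2 * ((am ^ 2) ^ t * A 0) := by ring
        _ ≤ _ := this
  have hBm := epoch_recursion_bound (pow_pos ham 2) hq0 hp0 hk0 hq1 hp1 hk1 hB0 rfl hW0 hBs hWs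
  have hAm' := hAm m le_rfl
  simp only [hB, hA, hY0, hYm] at hBm hAm'
  exact ⟨hBm, hAm'⟩

end CapModel

/-! ### The hypotheses of the theorem -/

/-- The hypotheses of the theorem provide the local model; the points over which `M`, `K` and `L`
are maximized enter only through the segments contained in `D`. -/
lemma capModel [NeZero d] {f : Fin n → E d → ℝ} {p : ℝ} (hf : ScaleInvariantFamily p f)
    {U D : Set (E d)} (hU : IsOpen U) (hD : IsCompact D) (hDU : D ⊆ U)
    (hf2 : ∀ i, ContDiffOn ℝ 2 (f i) U) (hf3 : ContDiffOn ℝ 3 (avg f) U) {ls : ℝ}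
    {lam : Fin d → ℝ} {v : OrthonormalBasis (Fin d) ℝ (E d)}
    (hls : gradient (avg f) (v 0) = ls • v 0)
    (hv : ∀ i, hessian (avg f) (v 0) (v i) = lam i • v i) (hgap : lamBar lam < ls) {s : ℕ}
    (hs : 1 ≤ s) (hsn : s ≤ n) {Δ : ℝ} (hΔ0 : 0 ≤ Δ) (hΔ1 : Δ ≤ 1 - 1 / √2)
    (hDseg : ContainsSegments (v 0) Δ D) :
    CapModel f p s (v 0) (hessian (avg f) (v 0)) ls (lamBar lam) ‖hessian (avg f) (v 0)‖
      (constM (avg f) ls lam v D) (constK f s D) (constL f s D) Δ := by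
  have hunit : ‖v 0‖ = 1 := v.orthonormal.1 0
  have hyD : ∀ y ∈ cap (v 0) Δ, y ∈ D := fun y hy => hDseg.1 y hy (left_mem_segment ℝ _ _)
  have hwD : ∀ y0 ∈ cap (v 0) Δ, ∀ y ∈ cap (v 0) Δ, ⟪y, y0⟫ • y0 ∈ D := fun y0 hy0 y hy =>
    hDseg.2 y hy y0 hy0 (right_mem_segment ℝ _ _)
  have hdiff : ∀ z ∈ D, ∀ i, DifferentiableAt ℝ (f i) z := fun z hz i =>
    ((hf2 i).differentiableOn (by norm_num)).differentiableAt (hU.mem_nhds (hDU hz))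
  exact
    { unit := hunit
      lb_nonneg := lamBar_nonneg
      lb_lt := hgap
      M_nonneg := (constM2_nonneg _ D).trans (le_max_right _ _)
      σ_nonneg := norm_nonneg _
      Δ_nonneg := hΔ0
      Δ_le := hΔ1
      K_nonneg := constK_nonneg f s D
      L_nonneg := constL_nonneg f s D
      card_pos := batches_card_pos hsn
      norm_H_le := fun u hu => norm_apply_le_lamBar hv hu
      inner_H := fun u hu => by
        rw [real_inner_comm, inner_apply_of_eigenbasis hv, real_inner_comm, hu, mul_zero]
      gradient_eq := fun y hy =>
        exists_gradient_eq hU hf3 hD hDU hls hv hy.1 (hDseg.1 y hy)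
      norm_gradient_sub_le := fun y hy =>
        norm_gradient_sub_smul_le hU hf3 hD hDU (lamBar_nonneg.trans hgap.le) hls hy.1
          (hDseg.1 y hy) hy.2
      step := fun η x0 x y0 y hx0 hx hy0 hy hy0c hyc S =>
        stepIter_eq hf hU hf2 η hx0 hx hy0 hy (inner_nonneg_of_mem_cap hunit hΔ1 hyc hy0c)
          (hDU (hyD y hyc)) (hDU (hwD y0 hy0c y hyc)) S
      noise_le := fun y0 hy0 y hy S hS => norm_noise_le hU hf2 hD hDU hS (hDseg.2 y hy y0 hy0)
      sum_noise := fun y0 hy0 y hy =>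
        sum_noise (hdiff _ (hyD y hy)) (hdiff _ (hwD y0 hy0 y hy)) hs hsn
      sum_noise_sq := fun y0 hy0 y hy =>
        sum_norm_noise_sq_le hU hf2 hD hDU hsn (hDseg.2 y hy y0 hy0) }

lemma mul_le_one_of_le_one_div_max {η c b : ℝ} (hη : 0 < η) (h : η ≤ 1 / max 1 c) (hb : b ≤ c) :
    η * b ≤ 1 := by
  have h1 : 0 < max 1 c := lt_max_of_lt_left one_pos
  rw [le_div_iff₀ h1] at h
  exact (mul_le_mul_of_nonneg_left (hb.trans (le_max_right _ _)) hη.le).trans h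

lemma theta2_nonneg {ls lb M L L0 Δ : ℝ} (hΔ : 0 ≤ Δ) (hgap : lb < ls)
    (hL : L ≤ L0) (h : 4 * (M + 2 * √L0) ^ 2 * Δ ≤ (ls - lb) ^ 2) :
    0 ≤ theta2 ls lb M L Δ := by
  have h1 : 2 * √Δ * (M + 2 * √L0) ≤ ls - lb := by
    refine abs_le_of_sq_le_sq' ?_ (by linarith) |>.2
    calc (2 * √Δ * (M + 2 * √L0)) ^ 2 = 4 * (M + 2 * √L0) ^ 2 * √Δ ^ 2 := by ring
      _ ≤ _ := by rwa [Real.sq_sqrt hΔ]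
  have h2 : 2 * √Δ * (M + 2 * √L) ≤ 2 * √Δ * (M + 2 * √L0) := by
    have := Real.sqrt_le_sqrt hL
    gcongr
  unfold theta2
  linarith

/-- The thresholds `ν₁` and `ν₃` make the displacement of the direction within one epoch small. -/
lemma displacement_bounds {ls lb σ M L Δ η : ℝ} {m : ℕ} (hlb : 0 ≤ lb) (hgap : lb < ls)
    (hσ : 0 ≤ σ) (hM : 0 ≤ M) (hL : 0 ≤ L) (hΔ0 : 0 ≤ Δ) (hΔ1 : Δ ≤ 1)
    (hγ : 0 < ls - lb - 2 * M * √Δ) (hm : 1 ≤ m) (hη0 : 0 < η) (hη1 : η ≤ 1)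
    (hθ2 : 0 ≤ theta2 ls lb M L Δ) (hden : nu3Den ls lb M L Δ ≠ 0)
    (h1 : η * nu1 ls σ M L Δ m ≤ 1) (h3 : η * nu3 ls lb σ M L Δ m ≤ 1) :
    8 * L * (m * η * theta1 ls σ M L Δ) ^ 2
        ≤ ((ls - lb - 2 * M * √Δ) * (1 - η + η * ls) / 2) ^ 2 ∧
      2 * m * (η * (theta1 ls σ M L Δ * √(2 * Δ))) ≤ 1 - η + η * ls := by
  have hls : 0 < ls := hlb.trans_lt hgap
  have hsΔ := Real.sqrt_nonneg Δ
  have hm1 : (1 : ℝ) ≤ m := by exact_mod_cast hm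
  have hθ1 : 0 ≤ theta1 ls σ M L Δ := by unfold theta1; positivity
  have hθ2γ : theta2 ls lb M L Δ ≤ ls - lb - 2 * M * √Δ := by
    have : 0 ≤ √Δ * √L := by positivity
    unfold theta2
    linarith
  set θ1 := theta1 ls σ M L Δ
  set θ2 := theta2 ls lb M L Δ with hθ2def
  set α := 1 - η + η * ls with hα
  have hα0 : 0 < α := by have := mul_pos hη0 hls; linarith
  have hc2 : 2 * m * (η * (θ1 * √(2 * Δ))) ≤ α := by
    have : η * nu1 ls σ M L Δ m = η * (1 - ls) + 2 * m * (η * (θ1 * √(2 * Δ))) := by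
      unfold nu1; ring
    linarith
  refine ⟨?_, hc2⟩
  have hden0 : 0 < nu3Den ls lb M L Δ := by
    refine lt_of_le_of_ne ?_ hden.symm
    unfold nu3Den
    positivity
  have hMΔ : 0 ≤ M * √Δ := by positivity
  set x := m * η * θ1 with hx
  have hx0 : 0 ≤ x := by positivity
  have e1 : 128 * L * x ≤ α * (θ2 ^ 2 * (Δ * √Δ)) := by
    have q1 : η * (128 * L * θ1 * ls * m ^ 2 / nu3Den ls lb M L Δ) ≤ α := by
      have : η * nu3 ls lb σ M L Δ m = η * (128 * L * θ1 * ls * m ^ 2 / nu3Den ls lb M L Δ)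
          + (η - η * (lb + M * √Δ)) := by unfold nu3; ring
      have q : η * (lb + M * √Δ) ≤ η * ls := mul_le_mul_of_nonneg_left (by linarith) hη0.le
      linarith
    rw [← mul_div_assoc, div_le_iff₀ hden0] at q1
    have q2 : nu3Den ls lb M L Δ ≤ θ2 ^ 2 * (Δ * √Δ) * ls := by
      calc nu3Den ls lb M L Δ = θ2 ^ 2 * (Δ * √Δ) * lb := by unfold nu3Den; ring
        _ ≤ _ := by gcongr
    have q3 : (128 * L * x * m) * ls ≤ (α * (θ2 ^ 2 * (Δ * √Δ))) * ls := by
      calc (128 * L * x * m) * ls = η * (128 * L * θ1 * ls * m ^ 2) := by rw [hx]; ring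
        _ ≤ α * (θ2 ^ 2 * (Δ * √Δ) * ls) := q1.trans (by gcongr)
        _ = _ := by ring
    have q4 := le_of_mul_le_mul_right q3 hls
    refine le_trans ?_ q4
    exact le_mul_of_one_le_right (by positivity) hm1
  have e2 : 2 * (x * √Δ) ≤ α := by
    have : √Δ ≤ √(2 * Δ) := Real.sqrt_le_sqrt (by linarith)
    calc 2 * (x * √Δ) = 2 * m * (η * (θ1 * √Δ)) := by rw [hx]; ring
      _ ≤ 2 * m * (η * (θ1 * √(2 * Δ))) := by gcongr
      _ ≤ α := hc2
  have e3 : 256 * L * x ^ 2 ≤ (α * θ2) ^ 2 := by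
    calc 256 * L * x ^ 2 = 2 * ((128 * L * x) * x) := by ring
      _ ≤ 2 * ((α * (θ2 ^ 2 * (Δ * √Δ))) * x) := by gcongr
      _ = (α * (θ2 ^ 2 * Δ)) * (2 * (x * √Δ)) := by ring
      _ ≤ (α * (θ2 ^ 2 * 1)) * α := by gcongr
      _ = _ := by ring
  have e4 : (α * θ2) ^ 2 ≤ (α * (ls - lb - 2 * M * √Δ)) ^ 2 := by gcongr
  have e5 : 0 ≤ (α * (ls - lb - 2 * M * √Δ)) ^ 2 := sq_nonneg _
  calc 8 * L * x ^ 2 ≤ (α * (ls - lb - 2 * M * √Δ)) ^ 2 / 32 := by linarith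
    _ ≤ (α * (ls - lb - 2 * M * √Δ)) ^ 2 / 4 := by linarith
    _ = _ := by ring

lemma div_le_mul_div_of_le {a0 a1 b0 b1 r R : ℝ} (ha0 : 0 ≤ a0) (hb0 : 0 < b0) (hr : 0 ≤ r)
    (hR : 0 < R) (ha : a1 ≤ r * (R * a0)) (hb : R * b0 ≤ b1) : a1 / b1 ≤ r * (a0 / b0) := by
  rw [div_le_iff₀ ((mul_pos hR hb0).trans_le hb)]
  calc a1 ≤ r * (R * a0) := ha
    _ = r * (a0 / b0) * (R * b0) := by field_simp
    _ ≤ r * (a0 / b0) * b1 := by gcongr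

/-- Geometric decay reaches the level `ε` after `⌈(1 / ρ) log (g 0 / ε)⌉` steps. -/
lemma le_of_geometric_decay {g : ℕ → ℝ} {ρ ε : ℝ} (hρ0 : 0 < ρ) (hρ1 : ρ < 1)
    (hg0 : 0 ≤ g 0) (hg : ∀ T, g (T + 1) ≤ (1 - ρ) * g T) (hε : 0 < ε) :
    g ⌈1 / ρ * Real.log (g 0 / ε)⌉₊ ≤ ε := by
  have h1 : ∀ T, g T ≤ (1 - ρ) ^ T * g 0 := by
    intro T
    induction T with
    | zero => simp
    | succ T ih =>
      calc g (T + 1) ≤ (1 - ρ) * g T := hg T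
        _ ≤ (1 - ρ) * ((1 - ρ) ^ T * g 0) := mul_le_mul_of_nonneg_left ih (by linarith)
        _ = _ := by ring
  set τ := ⌈1 / ρ * Real.log (g 0 / ε)⌉₊ with hτ
  refine (h1 τ).trans ?_
  rcases hg0.eq_or_lt with h0 | h0
  · rw [← h0, mul_zero]; exact hε.le
  have h2 : 1 / ρ * Real.log (g 0 / ε) ≤ τ := Nat.le_ceil _
  have h3 : Real.log (g 0 / ε) ≤ ρ * τ := by
    rw [one_div, inv_mul_le_iff₀ hρ0] at h2
    exact h2
  have h4 : (1 - ρ) ^ τ ≤ Real.exp (-(ρ * τ)) := by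
    calc (1 - ρ) ^ τ ≤ Real.exp (-ρ) ^ τ :=
          pow_le_pow_left₀ (by linarith) (Real.one_sub_le_exp_neg ρ) τ
      _ = _ := by rw [← Real.exp_nat_mul]; ring_nf
  have h5 : Real.exp (-(ρ * τ)) ≤ ε / g 0 := by
    calc Real.exp (-(ρ * τ)) ≤ Real.exp (-Real.log (g 0 / ε)) := Real.exp_le_exp.2 (by linarith)
      _ = ε / g 0 := by rw [Real.exp_neg, Real.exp_log (by positivity), inv_div]
  calc (1 - ρ) ^ τ * g 0 ≤ ε / g 0 * g 0 := by gcongr; exact h4.trans h5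
    _ = ε := div_mul_cancel₀ _ h0.ne'

end SSCIPI

theorem mainTheorem1
    {d n : ℕ} [NeZero d] (hd : 2 ≤ d)
    -- the finite-sum scale invariant problem
    (f : Fin n → SSCIPI.E d → ℝ) (p : ℝ) (hf : SSCIPI.ScaleInvariantFamily p f)
    -- smoothness on an open set containing the unit sphere and the range `D` of the points
    -- over which `M`, `K`, `L` are maximized (for example, `D` is the closed unit ball)
    (U D : Set (SSCIPI.E d)) (hU : IsOpen U) (hsphere : Metric.sphere 0 1 ⊆ U)
    (hD : IsCompact D) (hDU : D ⊆ U)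
    (hf2 : ∀ i, ContDiffOn ℝ 2 (f i) U) (hf3 : ContDiffOn ℝ 3 (SSCIPI.avg f) U)
    -- local maximizer, Lagrange multiplier, eigenpairs of the Hessian, eigen-gap
    (xstar : SSCIPI.E d) (hxstar : ‖xstar‖ = 1)
    (hmax : IsLocalMaxOn (SSCIPI.avg f) (Metric.sphere 0 1) xstar)
    (ls : ℝ) (hls : gradient (SSCIPI.avg f) xstar = ls • xstar)
    (lam : Fin d → ℝ) (v : OrthonormalBasis (Fin d) ℝ (SSCIPI.E d))
    (hv : ∀ i, SSCIPI.hessian (SSCIPI.avg f) xstar (v i) = lam i • v i)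
    (hv0 : v 0 = xstar)
    (lb : ℝ) (hlb : lb = SSCIPI.lamBar lam) (hgap : lb < ls)
    (σ : ℝ) (hσ : σ = ‖SSCIPI.hessian (SSCIPI.avg f) xstar‖)
    -- batch size, epoch length, step size, initial iterate
    (s : ℕ) (hs : 1 ≤ s) (hsn : s ≤ n) (m : ℕ) (hm : 1 ≤ m)
    (η : ℝ) (hη0 : 0 < η) (hη1 : η ≤ 1)
    (x0 : SSCIPI.E d) (hx0 : ‖x0‖ = 1)
    (Δ : ℝ) (hΔ : Δ = 1 - inner ℝ x0 xstar)
    (hDseg : SSCIPI.ContainsSegments xstar Δ D)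
    -- the constants
    (M K L L0 : ℝ) (hM : M = SSCIPI.constM (SSCIPI.avg f) ls lam v D)
    (hK : K = SSCIPI.constK f s D) (hL : L = SSCIPI.constL f s D)
    (hL0 : L0 = SSCIPI.constL f 1 D)
    -- the initial iterate is close enough to `xstar`
    (hΔ1 : Δ ≤ 1 - 1 / √2)
    (hΔ2 : 4 * (M + 2 * √L0) ^ 2 * Δ ≤ (ls - lb) ^ 2)
    (hΔ3 : 0 < ls - lb - 2 * M * √Δ)
    -- either `L` is small or `η` is small
    (hLη : L ≤ (ls - lb - 2 * M * √Δ) ^ 2 / 32 ∨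
      (SSCIPI.nu3Den ls lb M L Δ ≠ 0 ∧
        η ≤ 1 / max 1 (max (SSCIPI.nu1 ls σ M L Δ m)
          (max (SSCIPI.nu2 ls lb M Δ m) (SSCIPI.nu3 ls lb σ M L Δ m)))))
    -- the further bound on the step size
    (hη3 : η ≤ 1 / max 1 (max (SSCIPI.nu4 ls lb M K Δ m) (SSCIPI.nu5 ls lb M Δ m)))
    -- the random mini-batches and the outer iterates
    {Ω : Type*} [MeasurableSpace Ω] (μ : Measure Ω) [IsProbabilityMeasure μ]
    (S : ℕ → ℕ → Ω → Finset (Fin n)) (hS : SSCIPI.UniformBatches μ s S)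
    (X : ℕ → Ω → SSCIPI.E d)
    (hX : ∀ T ω, X T ω = SSCIPI.outerIter f p η m x0 (fun T' t => S T' t ω) T)
    (ρ : ℝ) (hρ : ρ = SSCIPI.rho ls lb M Δ η m) :
    (0 < ρ ∧ ρ < 1) ∧
    (∀ T, Integrable (fun ω => SSCIPI.tailSq v (X T ω)) μ ∧
      Integrable (fun ω => SSCIPI.headSq v (X T ω)) μ ∧
      0 < ∫ ω, SSCIPI.headSq v (X T ω) ∂μ) ∧
    (∀ T, SSCIPI.gap μ v (X (T + 1)) ≤ (1 - ρ) * SSCIPI.gap μ v (X T)) ∧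
    (∀ ε : ℝ, 0 < ε →
      SSCIPI.gap μ v (X ⌈1 / ρ * Real.log (SSCIPI.gap μ v (X 0) / ε)⌉₊) ≤ ε) := by
  subst hv0 hlb hσ hM hK hL hL0
  have hΔ0 : 0 ≤ Δ := by
    have := (abs_le.1 (abs_real_inner_le_norm x0 (v 0))).2
    rw [hx0, hxstar, mul_one] at this
    linarith
  have h := SSCIPI.capModel hf hU hD hDU hf2 hf3 hls hv hgap hs hsn hΔ0 hΔ1 hDseg
  have hLL := SSCIPI.constL_le_constL_one hU hf2 hD hDU hs
  set M := SSCIPI.constM (SSCIPI.avg f) ls lam v D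
  set K := SSCIPI.constK f s D
  set L := SSCIPI.constL f s D
  set lb := SSCIPI.lamBar lam
  set σ := ‖SSCIPI.hessian (SSCIPI.avg f) (v 0)‖
  set γ := ls - lb - 2 * M * √Δ with hγ
  have hMΔ : 0 ≤ M * √Δ := mul_nonneg h.M_nonneg (Real.sqrt_nonneg _)
  have hlb0 : 0 ≤ lb := h.lb_nonneg
  set am := 1 - η + η * (ls - M * √Δ) with hamdef
  have ham : 0 < am := by
    have := mul_pos hη0 (by linarith : 0 < ls - M * √Δ)
    linarith
  have hlog : 0 < Real.log 2 := Real.log_pos one_lt_two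
  have hn4 : 64 * η * K ≤ γ * (1 - η + η * (ls + M * √Δ)) := by
    have h1 := SSCIPI.mul_le_one_of_le_one_div_max
      (b := 1 - ls - M * √Δ + 64 * K / γ) hη0 hη3
      (le_max_of_le_left (add_le_add_right (le_max_right _ _) _))
    have h2 : 64 * η * K / γ ≤ 1 - η + η * (ls + M * √Δ) := by
      have : η * (1 - ls - M * √Δ + 64 * K / γ)
          = η * (1 - ls - M * √Δ) + 64 * η * K / γ := by ring
      linarith
    rwa [div_le_iff₀' hΔ3] at h2
  have hn5 : 2 * m * (η * γ) ≤ am := by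
    have h1 := SSCIPI.mul_le_one_of_le_one_div_max
      (b := 1 - ls + M * √Δ + 2 * m * γ) hη0 hη3
      (le_max_of_le_right (add_le_add_right (le_max_left _ _) _))
    linarith
  have hn5' : 4 * m * (η * (M * √Δ)) ≤ Real.log 2 * am := by
    have h1 := SSCIPI.mul_le_one_of_le_one_div_max
      (b := 1 - ls + M * √Δ + 4 * m * M * √Δ / Real.log 2) hη0 hη3
      (le_max_of_le_right (add_le_add_right (le_max_right _ _) _))
    have h2 : 4 * m * (η * (M * √Δ)) / Real.log 2 ≤ am := by
      have : η * (1 - ls + M * √Δ + 4 * m * M * √Δ / Real.log 2)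
          = η * (1 - ls + M * √Δ) + 4 * m * (η * (M * √Δ)) / Real.log 2 := by ring
      linarith
    rwa [div_le_iff₀' hlog] at h2
  have hcone := fun y (hy : y ∈ SSCIPI.cone (v 0) Δ) (A : ℕ → Finset (Fin n))
      (hA : ∀ t < m, A t ∈ SSCIPI.batches n s) => h.innerIter_mem_cone hη0 hη1 hΔ3 (m := m)
    (hLη.imp_right fun ⟨hden, hη⟩ => SSCIPI.displacement_bounds hlb0 hgap h.σ_nonneg h.M_nonneg
      h.L_nonneg hΔ0 (by linarith [SSCIPI.delta_lt hΔ1]) hΔ3 hm hη0 hη1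
      (SSCIPI.theta2_nonneg hΔ0 hgap hLL hΔ2) hden
      (SSCIPI.mul_le_one_of_le_one_div_max hη0 hη (le_max_left _ _))
      (SSCIPI.mul_le_one_of_le_one_div_max hη0 hη
        ((le_max_right _ _).trans (le_max_right _ _)))) hy hA
  have hx0c : x0 ∈ SSCIPI.cone (v 0) Δ := by
    refine ⟨by rw [hx0]; exact one_pos, ?_⟩
    rw [hx0, hΔ]
    linarith
  have hρ' : ρ = m * (η * γ / am) / 2 := by
    rw [hρ, SSCIPI.rho, ← hγ, ← hamdef]
    ring_nf
  have hepoch : ∀ T, (∫ ω, ‖SSCIPI.tl (v 0) (X (T + 1) ω)‖ ^ 2 ∂μ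
        ≤ (1 - ρ) * ((am ^ 2) ^ m * ∫ ω, ‖SSCIPI.tl (v 0) (X T ω)‖ ^ 2 ∂μ)) ∧
      (am ^ 2) ^ m * ∫ ω, SSCIPI.headSq v (X T ω) ∂μ
        ≤ ∫ ω, SSCIPI.headSq v (X (T + 1) ω) ∂μ := by
    intro T
    rw [hρ']
    exact h.epoch_integral hη0 hη1 hm hΔ3 hcone ham hn4 hn5 hn5' hS hsn hx0c hX T
  have hρ0 : 0 < ρ := by
    rw [hρ']
    have := mul_pos hη0 hΔ3
    positivity
  have hρ1 : ρ < 1 := by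
    rw [hρ', mul_div_assoc', div_div, div_lt_one (by positivity)]
    linarith
  have hdep : ∀ T (φ : SSCIPI.E d → ℝ), Integrable (fun ω => φ (X T ω)) μ := by
    intro T φ
    have := hS.integrable ((SSCIPI.dependsOnBatches_iterates f p η m x0 S T 0).comp
      fun z => φ z.1)
    simpa only [hX] using this
  have hR : 0 < (am ^ 2) ^ m := by positivity
  have hpos : ∀ T, 0 < ∫ ω, SSCIPI.headSq v (X T ω) ∂μ := by
    intro T
    induction T with
    | zero =>
      have h0 : ∀ ω, X 0 ω = x0 := fun ω => hX 0 ω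
      simp only [h0, SSCIPI.headSq, integral_const, probReal_univ, one_smul]
      exact pow_pos (h.head_pos hx0c) 2
    | succ T ih => exact lt_of_lt_of_le (mul_pos hR ih) (hepoch T).2
  have hstep : ∀ T, SSCIPI.gap μ v (X (T + 1)) ≤ (1 - ρ) * SSCIPI.gap μ v (X T) := by
    intro T
    simp only [SSCIPI.gap, SSCIPI.tailSq_eq]
    exact SSCIPI.div_le_mul_div_of_le (integral_nonneg fun ω => sq_nonneg _) (hpos T)
      (by linarith) hR (hepoch T).1 (hepoch T).2
  refine ⟨⟨hρ0, hρ1⟩, fun T => ⟨hdep T _, hdep T _, hpos T⟩, hstep, fun ε hε => ?_⟩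
  refine SSCIPI.le_of_geometric_decay (g := fun T => SSCIPI.gap μ v (X T)) hρ0 hρ1 ?_ hstep hε
  have hA := (hpos 0).le
  exact div_nonneg (integral_nonneg fun ω => Finset.sum_nonneg fun k _ => sq_nonneg _) hA
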